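/- Let $1\le p<\infty$ and let $(e_k)_{k\ge 0}$ be the canonical basis of the complex space $\ell^p(\mathbb N)$, $\mathbb N=\{0,1,2,\dots\}$. Let $v=(v_n)_{n\ge1}$, $w=(w_k)_{k\ge1}$, $\varphi:\mathbb N\to\mathbb N$ and $b=(b_n)_{n\ge0}$ be such that - the $v_n$ are non-zero complex numbers with $\sum_{n\ge1}|v_n|<\infty$; - the $w_k$ are complex numbers with $0<\inf_k|w_k|\le\sup_k|w_k|<\infty$, and $\inf_{n\ge0}|W_n|>0$, where $W_n=\prod_{b_n<j<b_{n+1}}w_j$; - $\varphi(0)=0$, $\varphi(n)<n$ for every $n\ge1$, and $\varphi^{-1}(\{l\})$ is infinite for every $l\ge0$; - $b$ is a strictly increasing sequence of integers with $b_0=0$, and $b_{n+1}-b_n$ is a multiple of $2(b_{\varphi(n)+1}-b_{\varphi(n)})$ for every $n\ge1$. Let $T$ be the bounded operator on $\ell^p(\mathbb N)$ (the operator of C-type $T_{v,w,\varphi,b}$) given by $$Te_k=\begin{cases} w_{k+1}e_{k+1} & \text{if } k\in[b_n,b_{n+1}-1),\ n\ge0,\\ v_ne_{b_{\varphi(n)}}-W_n^{-1}e_{b_n}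 & \text{if } k=b_{n+1}-1,\ n\ge1,\\ -W_0^{-1}e_0 & \text{if } k=b_1-1.\end{cases}$$ Let $(\tau^{(k)})_{k\ge1}$, $(\delta^{(k)})_{k\ge1}$, $(\eta^{(k)})_{k\ge1}$ be strictly increasing sequences of positive integers and $(\Delta^{(k)})_{k\ge1}$ a sequence of positive integers with $4\delta^{(k)}+2\eta^{(k)}<\Delta^{(k)}$ for all $k\ge1$. Suppose that $T$ is of C$^+$-type with these data, i.e. for every $k\ge1$ and every integer $n\in[2^{k-1},2^k)$: $\varphi(n)=n-2^{k-1}$, $b_{n+1}-b_n=\Delta^{(k)}$, $v_n=2^{-\tau^{(k)}}$, and $w_{b_n+i}=w^{(k)}_i$ for $1\le i<\Delta^{(k)}$, where $$w^{(k)}_i=\begin{cases} \frac12 & \text{if } 1\le i\le\delta^{(k)},\\ 2 & \text{if } \delta^{(k)}<i\le2\delta^{(k)},\\ 1 & \text{if } 2\delta^{(k)}<i<\Delta^{(k)}-2\delta^{(k)}-2\eta^{(k)},\\ \frac12 & \text{if } \Delta^{(k)}-2\delta^{(k)}-2\eta^{(k)}\le i<\Delta^{(k)}-\delta^{(k)}-2\eta^{(k)},\\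 1 & \text{if } \Delta^{(k)}-\delta^{(k)}-2\eta^{(k)}\le i<\Delta^{(k)}-\delta^{(k)}-\eta^{(k)},\\ 2 & \text{if } \Delta^{(k)}-\delta^{(k)}-\eta^{(k)}\le i<\Delta^{(k)}-\eta^{(k)},\\ 1 & \text{if } \Delta^{(k)}-\eta^{(k)}\le i<\Delta^{(k)}.\end{cases}$$ Suppose that the sequence $\gamma_k:=2^{-\tau^{(k)}}(\Delta^{(k)})^{1-\frac1p}$, $k\ge1$, is non-increasing with $\sum_{k\ge1}2^k\gamma_k^{1/2}\le1$, that $$4\delta^{(k)}+3\eta^{(k)}\le\Delta^{(k)}\le\eta^{(k+1)}\quad\text{for every } k\ge1,$$ and that $\lim_{k\to\infty}\eta^{(k)}/\Delta^{(k)}=0$ and $\lim_{k\to\infty}\delta^{(k)}/\eta^{(k)}=0$. For $A\subseteq\mathbb N$ write $\underline{\mathrm{dens}}\,A=\liminf_{N\to\infty}\frac{\#(A\cap[0,N])}{N+1}$ and $\overline{\mathrm{dens}}\,A=\limsup_{N\to\infty}\frac{\#(A\cap[0,N])}{N+1}$, and put $\mathcal N_T(x,U)=\{n\ge0: T^nx\in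 U\}$. Then for every hypercyclic vector $x$ of $T$ (i.e. every $x$ whose orbit $\{T^nx:n\ge0\}$ is dense) there exists $\varepsilon>0$ such that $\underline{\mathrm{dens}}\,\mathcal N_T(x,B(0,\varepsilon)^c)=1$, where $B(0,\varepsilon)$ is the open ball of radius $\varepsilon$ centred at $0$. Moreover $T$ is not $\mathcal U$-frequently hypercyclic, i.e. there is no $x\in\ell^p(\mathbb N)$ such that $\overline{\mathrm{dens}}\,\mathcal N_T(x,U)>0$ for every non-empty open set $U\subseteq\ell^p(\mathbb N)$. -/

import Mathlib

open Filter Topology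
open scoped ENNReal

/-! ### Densities and linear dynamics -/

/-- The lower density `liminf_N #(A ∩ [0, N]) / (N + 1)` of a set of natural numbers. -/
noncomputable def lowerDens (A : Set ℕ) : ℝ :=
  liminf (fun N : ℕ => ((A ∩ Set.Iic N).ncard : ℝ) / ((N : ℝ) + 1)) atTop

/-- The upper density `limsup_N #(A ∩ [0, N]) / (N + 1)` of a set of natural numbers. -/
noncomputable def upperDens (A : Set ℕ) : ℝ :=
  limsup (fun N : ℕ => ((A ∩ Set.Iic N).ncard : ℝ) / ((N : ℝ) + 1)) atTop

section Dynamics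

variable {E : Type*} [NormedAddCommGroup E] [NormedSpace ℂ E]

/-- The set of return times `{n ≥ 0 : T ^ n x ∈ U}`. -/
def returnTimes (T : E →L[ℂ] E) (x : E) (U : Set E) : Set ℕ :=
  {n | (T ^ n) x ∈ U}

/-- The orbit `{T ^ n x : n ≥ 0}` is dense. -/
def IsHypercyclicVector (T : E →L[ℂ] E) (x : E) : Prop :=
  Dense (Set.range fun n : ℕ => (T ^ n) x)

/-- Every nonempty open set is visited by the orbit of `x` with positive upper density. -/
def IsUFrequentlyHypercyclicVector (T : E →L[ℂ] E) (x : E) : Prop :=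
  ∀ U : Set E, IsOpen U → U.Nonempty → 0 < upperDens (returnTimes T x U)

/-- `T` is `𝒰`-frequently hypercyclic. -/
def IsUFrequentlyHypercyclic (T : E →L[ℂ] E) : Prop :=
  ∃ x : E, IsUFrequentlyHypercyclicVector T x

end Dynamics

/-! ### Operators of C-type -/

/-- The complex sequence space `ℓ^p(ℕ)`. -/
abbrev SeqSpace (p : ℝ≥0∞) : Type := lp (fun _ : ℕ => ℂ) p

/-- The canonical basis vector `e_k`. -/
noncomputable def basisVec (p : ℝ≥0∞) (k : ℕ) : SeqSpace p := lp.single p k (1 : ℂ)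

/-- The parameters `v, w, φ, b` of an operator of C-type. The sequences `v` and `w` are indexed by
the integers `≥ 1`; the values `v 0` and `w 0` play no role. -/
structure CTypeParams where
  v : ℕ → ℂ
  w : ℕ → ℂ
  φ : ℕ → ℕ
  b : ℕ → ℕ
  v_ne_zero : ∀ n, 1 ≤ n → v n ≠ 0
  v_summable : Summable fun n : ℕ => ‖v (n + 1)‖
  w_bounded_below : ∃ c : ℝ, 0 < c ∧ ∀ k, 1 ≤ k → c ≤ ‖w k‖
  w_bounded : ∃ C : ℝ, ∀ k, 1 ≤ k → ‖w k‖ ≤ C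
  W_bounded_below :
    ∃ c : ℝ, 0 < c ∧ ∀ n, c ≤ ‖∏ j ∈ Finset.Ioo (b n) (b (n + 1)), w j‖
  φ_zero : φ 0 = 0
  φ_lt : ∀ n, 1 ≤ n → φ n < n
  φ_fiber_infinite : ∀ l, {n | φ n = l}.Infinite
  b_strictMono : StrictMono b
  b_zero : b 0 = 0
  b_dvd : ∀ n, 1 ≤ n → 2 * (b (φ n + 1) - b (φ n)) ∣ b (n + 1) - b n

namespace CTypeParams

/-- `W_n`, the product of the weights `w_j` over `b_n < j < b_{n+1}`. -/
noncomputable def W (P : CTypeParams) (n : ℕ) : ℂ :=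
  ∏ j ∈ Finset.Ioo (P.b n) (P.b (n + 1)), P.w j

/-- `T` is the operator of C-type with parameters `P`, described by its action on the canonical
basis. -/
structure IsOperator (P : CTypeParams) {p : ℝ≥0∞} [Fact (1 ≤ p)]
    (T : SeqSpace p →L[ℂ] SeqSpace p) : Prop where
  shift : ∀ n k, P.b n ≤ k → k + 1 < P.b (n + 1) →
    T (basisVec p k) = P.w (k + 1) • basisVec p (k + 1)
  last : ∀ n, 1 ≤ n →
    T (basisVec p (P.b (n + 1) - 1)) =
      P.v n • basisVec p (P.b (P.φ n)) - (P.W n)⁻¹ • basisVec p (P.b n)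
  last_zero : T (basisVec p (P.b 1 - 1)) = -(P.W 0)⁻¹ • basisVec p 0

end CTypeParams

/-- Bounded weighted composition by an injective map on `ℓ^p(ℕ)`, `p < ∞`. -/
theorem exists_weightedComp {p : ℝ≥0∞} [Fact (1 ≤ p)] (hp : p ≠ ∞) (ρ : ℕ → ℕ)
    (hρ : Function.Injective ρ) (c : ℕ → ℂ) (C : ℝ) (hc : ∀ j, ‖c j‖ ≤ C) :
    ∃ D : SeqSpace p →L[ℂ] SeqSpace p, ∀ x j, D x j = c j * x (ρ j) := by
  have hp0 : 0 < p.toReal :=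
    ENNReal.toReal_pos (zero_lt_one.trans_le Fact.out).ne' hp
  have hC : 0 ≤ C := (norm_nonneg _).trans (hc 0)
  have key : ∀ (x : SeqSpace p) (s : Finset ℕ),
      ∑ j ∈ s, ‖c j * x (ρ j)‖ ^ p.toReal ≤ (C * ‖x‖) ^ p.toReal := by
    intro x s
    calc ∑ j ∈ s, ‖c j * x (ρ j)‖ ^ p.toReal
        ≤ ∑ j ∈ s, C ^ p.toReal * ‖x (ρ j)‖ ^ p.toReal := by
          refine Finset.sum_le_sum fun j _ => ?_
          rw [norm_mul, Real.mul_rpow (norm_nonneg _) (norm_nonneg _)]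
          gcongr
          exact hc j
      _ = C ^ p.toReal * ∑ i ∈ s.image ρ, ‖x i‖ ^ p.toReal := by
          rw [Finset.sum_image (fun a _ b _ h => hρ h), Finset.mul_sum]
      _ ≤ C ^ p.toReal * ‖x‖ ^ p.toReal := by
          gcongr
          exact lp.sum_rpow_le_norm_rpow hp0 x _
      _ = (C * ‖x‖) ^ p.toReal := (Real.mul_rpow hC (norm_nonneg _)).symm
  let L : SeqSpace p →ₗ[ℂ] SeqSpace p :=
    { toFun := fun x => ⟨fun j => c j * x (ρ j), memℓp_gen' (key x)⟩
      map_add' := fun x y => by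
        ext j
        exact mul_add (c j) (x (ρ j)) (y (ρ j))
      map_smul' := fun a x => by
        ext j
        simp [mul_left_comm] }
  refine ⟨L.mkContinuous C fun x => ?_, fun x j => rfl⟩
  exact lp.norm_le_of_forall_sum_le hp0 (mul_nonneg hC (norm_nonneg _)) (key x)

/-- A continuous operator on `ℓ^p(ℕ)`, `p < ∞`, is determined by its values on the basis. -/
theorem eq_of_basisVec {p : ℝ≥0∞} [Fact (1 ≤ p)] (hp : p ≠ ∞)
    (S T : SeqSpace p →L[ℂ] SeqSpace p) (h : ∀ k, S (basisVec p k) = T (basisVec p k)) :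
    S = T := by
  ext1 x
  have hx := lp.hasSum_single hp x
  have hs := hx.mapL S
  have ht := hx.mapL T
  refine hs.unique (ht.congr_fun ?_)
  intro k
  have : lp.single p k (x k) = x k • basisVec p k := by
    rw [basisVec, ← lp.single_smul]; simp
  simp [this, h]

namespace CTypeParams

theorem exists_diagonal_part (P : CTypeParams) {p : ℝ≥0∞} [Fact (1 ≤ p)] (hp : p ≠ ∞) :
    ∃ D : SeqSpace p →L[ℂ] SeqSpace p,
      (∀ n k, P.b n ≤ k → k + 1 < P.b (n + 1) →
        D (basisVec p k) = P.w (k + 1) • basisVec p (k + 1)) ∧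
      ∀ n, D (basisVec p (P.b (n + 1) - 1)) = -(P.W n)⁻¹ • basisVec p (P.b n) := by
  classical
  obtain ⟨C, hC⟩ := P.w_bounded
  obtain ⟨d, hd, hW⟩ := P.W_bounded_below
  have hpos : ∀ n, 0 < P.b (n + 1) := fun n =>
    (Nat.zero_le _).trans_lt (P.b_strictMono (Nat.lt_succ_self n))
  let ρ : ℕ → ℕ := fun j => if h : ∃ n, P.b n = j then P.b (h.choose + 1) - 1 else j - 1
  let c : ℕ → ℂ := fun j => if h : ∃ n, P.b n = j then -(P.W h.choose)⁻¹ else P.w j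
  have hρb : ∀ n, ρ (P.b n) = P.b (n + 1) - 1 := by
    intro n
    have h : ∃ m, P.b m = P.b n := ⟨n, rfl⟩
    have : h.choose = n := P.b_strictMono.injective h.choose_spec
    simp only [ρ, dif_pos h, this]
  have hcb : ∀ n, c (P.b n) = -(P.W n)⁻¹ := by
    intro n
    have h : ∃ m, P.b m = P.b n := ⟨n, rfl⟩
    have : h.choose = n := P.b_strictMono.injective h.choose_spec
    simp only [c, dif_pos h, this]
  have hρn : ∀ j, (¬ ∃ n, P.b n = j) → ρ j = j - 1 := fun j h => by simp only [ρ, dif_neg h]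
  have hcn : ∀ j, (¬ ∃ n, P.b n = j) → c j = P.w j := fun j h => by simp only [c, dif_neg h]
  have hjpos : ∀ j, (¬ ∃ n, P.b n = j) → 1 ≤ j := fun j h => by
    rcases Nat.eq_zero_or_pos j with rfl | h'
    · exact absurd ⟨0, P.b_zero⟩ h
    · exact h'
  have hρ : Function.Injective ρ := by
    intro i j hij
    by_cases hi : ∃ n, P.b n = i <;> by_cases hj : ∃ n, P.b n = j
    · obtain ⟨n, rfl⟩ := hi
      obtain ⟨m, rfl⟩ := hj
      rw [hρb, hρb] at hij
      have h1 := hpos n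
      have h2 := hpos m
      have : n + 1 = m + 1 := P.b_strictMono.injective (by omega)
      rw [Nat.succ_injective this]
    · obtain ⟨n, rfl⟩ := hi
      rw [hρb, hρn j hj] at hij
      have h1 := hpos n
      have h2 := hjpos j hj
      exact absurd ⟨n + 1, by omega⟩ hj
    · obtain ⟨n, rfl⟩ := hj
      rw [hρb, hρn i hi] at hij
      have h1 := hpos n
      have h2 := hjpos i hi
      exact absurd ⟨n + 1, by omega⟩ hi
    · rw [hρn i hi, hρn j hj] at hij
      have h1 := hjpos i hi
      have h2 := hjpos j hj
      omega
  have hc : ∀ j, ‖c j‖ ≤ max C d⁻¹ := by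
    intro j
    by_cases hj : ∃ n, P.b n = j
    · obtain ⟨n, rfl⟩ := hj
      rw [hcb, norm_neg, norm_inv]
      exact (inv_anti₀ hd (hW n)).trans (le_max_right _ _)
    · rw [hcn j hj]
      exact (hC j (hjpos j hj)).trans (le_max_left _ _)
  obtain ⟨D, hD⟩ := exists_weightedComp hp ρ hρ c _ hc
  have hDe : ∀ j, D (basisVec p (ρ j)) = c j • basisVec p j := by
    intro j
    ext i
    rw [hD]
    by_cases h : i = j
    · subst h
      simp [basisVec]
    · have : ρ i ≠ ρ j := fun h' => h (hρ h')
      simp [basisVec, h, this]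
  refine ⟨D, fun n k h1 h2 => ?_, fun n => ?_⟩
  · have hk : ¬ ∃ m, P.b m = k + 1 := by
      rintro ⟨m, hm⟩
      have a1 : n < m := P.b_strictMono.lt_iff_lt.1 (by omega)
      have a2 : m < n + 1 := P.b_strictMono.lt_iff_lt.1 (by omega)
      omega
    have := hDe (k + 1)
    rwa [hρn _ hk, hcn _ hk, Nat.add_sub_cancel] at this
  · have := hDe (P.b n)
    rwa [hρb, hcb] at this

theorem exists_perturbation_part (P : CTypeParams) {p : ℝ≥0∞} [Fact (1 ≤ p)] :
    ∃ R : SeqSpace p →L[ℂ] SeqSpace p,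
      (∀ k, (∀ n, 1 ≤ n → k ≠ P.b (n + 1) - 1) → R (basisVec p k) = 0) ∧
      ∀ n, 1 ≤ n → R (basisVec p (P.b (n + 1) - 1)) = P.v n • basisVec p (P.b (P.φ n)) := by
  have hp0 : p ≠ 0 := (zero_lt_one.trans_le (Fact.out : 1 ≤ p)).ne'
  let ev : ℕ → SeqSpace p →L[ℂ] ℂ := fun k =>
    LinearMap.mkContinuous
      { toFun := fun x => x k
        map_add' := fun _ _ => rfl
        map_smul' := fun _ _ => rfl } 1
      (fun x => (lp.norm_apply_le_norm hp0 x k).trans_eq (one_mul _).symm)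
  have hev : ∀ k (x : SeqSpace p), ev k x = x k := fun _ _ => rfl
  let r : ℕ → SeqSpace p →L[ℂ] SeqSpace p := fun n =>
    P.v (n + 1) • (ev (P.b (n + 2) - 1)).smulRight (basisVec p (P.b (P.φ (n + 1))))
  have hr : ∀ n x, r n x =
      P.v (n + 1) • x (P.b (n + 2) - 1) • basisVec p (P.b (P.φ (n + 1))) := fun _ _ => rfl
  have hsum : Summable r := by
    refine Summable.of_norm_bounded P.v_summable fun n => ?_
    refine ContinuousLinearMap.opNorm_le_bound _ (norm_nonneg _) fun x => ?_
    have h1 : ‖basisVec p (P.b (P.φ (n + 1)))‖ = 1 := by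
      rw [basisVec, lp.norm_single (pos_iff_ne_zero.2 hp0)]
      simp
    rw [hr, norm_smul, norm_smul, h1, mul_one]
    gcongr
    exact lp.norm_apply_le_norm hp0 x _
  have happ : ∀ x, HasSum (fun n => r n x) ((∑' n, r n) x) := fun x =>
    hsum.hasSum.mapL (ContinuousLinearMap.apply ℂ (SeqSpace p) x)
  have hinj : ∀ m n, P.b (m + 1) - 1 = P.b (n + 1) - 1 → m = n := by
    intro m n h
    have h1 : P.b m < P.b (m + 1) := P.b_strictMono (Nat.lt_succ_self m)
    have h2 : P.b n < P.b (n + 1) := P.b_strictMono (Nat.lt_succ_self n)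
    have : m + 1 = n + 1 := P.b_strictMono.injective (by omega)
    omega
  refine ⟨∑' n, r n, fun k hk => ?_, fun n hn => ?_⟩
  · refine (happ _).unique ?_
    convert hasSum_zero using 2 with n
    rw [hr]
    have := hk (n + 1) (by omega)
    simp [basisVec, this.symm]
  · obtain ⟨m, rfl⟩ : ∃ m, n = m + 1 := ⟨n - 1, by omega⟩
    refine (happ _).unique ?_
    have := hasSum_single (f := fun n => r n (basisVec p (P.b (m + 1 + 1) - 1))) m ?_
    · convert this using 1
      rw [hr]
      simp [basisVec]
    · intro n hnm
      rw [hr]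
      have : P.b (n + 2) - 1 ≠ P.b (m + 1 + 1) - 1 := fun h => hnm (by
        have := hinj (n + 1) (m + 1) h
        omega)
      simp [basisVec, this]

theorem IsOperator.unique {P : CTypeParams} {p : ℝ≥0∞} [Fact (1 ≤ p)] (hp : p ≠ ∞)
    {S T : SeqSpace p →L[ℂ] SeqSpace p} (hS : P.IsOperator S) (hT : P.IsOperator T) : S = T := by
  classical
  refine eq_of_basisVec hp _ _ fun k => ?_
  have hex : ∃ m, k < P.b m := ⟨k + 1, Nat.lt_of_succ_le P.b_strictMono.le_apply⟩
  obtain ⟨n, hn⟩ : ∃ n, Nat.find hex = n + 1 := by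
    refine Nat.exists_eq_succ_of_ne_zero fun h => ?_
    have h1 := Nat.find_spec hex
    rw [h, P.b_zero] at h1
    omega
  have h1 : k < P.b (n + 1) := hn ▸ Nat.find_spec hex
  have h2 : P.b n ≤ k := not_lt.1 (Nat.find_min hex (by omega))
  by_cases h3 : k + 1 < P.b (n + 1)
  · rw [hS.shift n k h2 h3, hT.shift n k h2 h3]
  · obtain rfl : k = P.b (n + 1) - 1 := by omega
    rcases Nat.eq_zero_or_pos n with rfl | h4
    · exact hS.last_zero.trans hT.last_zero.symm
    · rw [hS.last n h4, hT.last n h4]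

/-- For `1 ≤ p < ∞` there is exactly one bounded operator with the prescribed values on the
canonical basis. -/
theorem existsUnique_operator (P : CTypeParams) {p : ℝ≥0∞} [Fact (1 ≤ p)] (hp : p ≠ ∞) :
    ∃! T : SeqSpace p →L[ℂ] SeqSpace p, P.IsOperator T := by
  obtain ⟨D, hD1, hD2⟩ := P.exists_diagonal_part hp
  obtain ⟨R, hR1, hR2⟩ := P.exists_perturbation_part (p := p)
  have hDR : P.IsOperator (D + R) := by
    refine ⟨fun n k h1 h2 => ?_, fun n hn => ?_, ?_⟩
    · have hk : ∀ m, 1 ≤ m → k ≠ P.b (m + 1) - 1 := by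
        intro m hm h
        have h0 : 0 < P.b (m + 1) := (Nat.zero_le _).trans_lt (P.b_strictMono (Nat.lt_succ_self m))
        have a1 : n < m + 1 := P.b_strictMono.lt_iff_lt.1 (by omega)
        have a2 : m + 1 < n + 1 := P.b_strictMono.lt_iff_lt.1 (by omega)
        omega
      simp [hD1 n k h1 h2, hR1 k hk]
    · simp [hD2 n, hR2 n hn, sub_eq_neg_add]
    · have hk : ∀ m, 1 ≤ m → P.b 1 - 1 ≠ P.b (m + 1) - 1 := by
        intro m hm h
        have h0 : 0 < P.b 1 := (Nat.zero_le _).trans_lt (P.b_strictMono (Nat.lt_succ_self 0))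
        have a1 : P.b 1 < P.b (m + 1) := P.b_strictMono (by omega)
        omega
      have := hD2 0
      simp only [zero_add, P.b_zero] at this
      simp [this, hR1 _ hk]
  exact ⟨D + R, hDR, fun S hS => hS.unique hp hDR⟩

/-- The operator of C-type `T_{v,w,φ,b}` on `ℓ^p(ℕ)`, `1 ≤ p < ∞`: the unique bounded operator
with `P.IsOperator T`. -/
noncomputable def operator (P : CTypeParams) (p : ℝ≥0∞) [Fact (1 ≤ p)] (hp : p ≠ ∞) :
    SeqSpace p →L[ℂ] SeqSpace p :=
  (P.existsUnique_operator hp).choose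

theorem operator_spec (P : CTypeParams) (p : ℝ≥0∞) [Fact (1 ≤ p)] (hp : p ≠ ∞) :
    P.IsOperator (P.operator p hp) :=
  (P.existsUnique_operator hp).choose_spec.1

/-- The C-type parameters `P` are of C⁺-type, with block sizes `Δ k`, coefficients `v' k` and
weights `w' k i`, `1 ≤ i < Δ k`, on the blocks number `n ∈ [2^(k-1), 2^k)`, for all `k ≥ 1`. -/
structure IsCPlus (P : CTypeParams) (Δ : ℕ → ℕ) (v' : ℕ → ℂ) (w' : ℕ → ℕ → ℂ) : Prop where
  φ_eq : ∀ k, 1 ≤ k → ∀ n, 2 ^ (k - 1) ≤ n → n < 2 ^ k → P.φ n = n - 2 ^ (k - 1)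
  size_eq : ∀ k, 1 ≤ k → ∀ n, 2 ^ (k - 1) ≤ n → n < 2 ^ k → P.b (n + 1) - P.b n = Δ k
  v_eq : ∀ k, 1 ≤ k → ∀ n, 2 ^ (k - 1) ≤ n → n < 2 ^ k → P.v n = v' k
  w_eq : ∀ k, 1 ≤ k → ∀ n, 2 ^ (k - 1) ≤ n → n < 2 ^ k →
    ∀ i, 1 ≤ i → i < Δ k → P.w (P.b n + i) = w' k i

end CTypeParams

/-- The weights `w_i`, `1 ≤ i < Δ`, on one block of size `Δ > 4δ + 2η`: consecutively
`1/2` (`δ` times), `2` (`δ` times), `1`, then `1/2` (`δ` times, from `i = Δ - 2δ - 2η`),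
`1` (`η` times), `2` (`δ` times), and `1` for `Δ - η ≤ i < Δ`. -/
noncomputable def blockWeight (Δ δ η i : ℕ) : ℂ :=
  if i ≤ δ then 1 / 2
  else if i ≤ 2 * δ then 2
  else if i + 2 * δ + 2 * η < Δ then 1
  else if i + δ + 2 * η < Δ then 1 / 2
  else if i + δ + η < Δ then 1
  else if i + η < Δ then 2
  else 1

/-- The C⁺-type parameters `P` have `v^(k) = 2^(-τ^(k))` and the block weights above, where `τ`,
`δ`, `η` are strictly increasing sequences of positive integers, indexed by `k ≥ 1`, with
`4δ^(k) + 2η^(k) < Δ^(k)`. -/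
structure IsSpecialCPlus (P : CTypeParams) (Δ τ δ η : ℕ → ℕ) : Prop where
  isCPlus : P.IsCPlus Δ (fun k => (2 : ℂ) ^ (-(τ k : ℤ))) (fun k => blockWeight (Δ k) (δ k) (η k))
  τ_pos : ∀ k, 1 ≤ k → 0 < τ k
  δ_pos : ∀ k, 1 ≤ k → 0 < δ k
  η_pos : ∀ k, 1 ≤ k → 0 < η k
  τ_strictMonoOn : StrictMonoOn τ (Set.Ici 1)
  δ_strictMonoOn : StrictMonoOn δ (Set.Ici 1)
  η_strictMonoOn : StrictMonoOn η (Set.Ici 1)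
  lt_Δ : ∀ k, 1 ≤ k → 4 * δ k + 2 * η k < Δ k

/-- `γ_k = 2^(-τ^(k)) (Δ^(k))^(1 - 1/p)`. -/
noncomputable def gammaSeq (p : ℝ≥0∞) (τ Δ : ℕ → ℕ) (k : ℕ) : ℝ :=
  (2 : ℝ) ^ (-(τ k : ℤ)) * (Δ k : ℝ) ^ (1 - 1 / p.toReal)

/-! Cut `x` into its parts on the blocks `[b_n, b_{n+1})`. Seen inside block `l ≥ 1`, `T` rotates
the part of `x` lying there: its coordinates along the vectors `T ^ i e_{b_l}` keep their moduli,
and the actual entries are these coordinates times a product of weights. That product is at most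
`1`, and equals `1` outside `4δ + η` of the `Δ` positions. The other blocks disturb this only if
their level is higher: at time `j`, block `n` contributes at most `γ` times the mass of its last `j`
coordinates (`norm_blockProj_pow_blockPart_le`). Writing `γ = γ^(1/2) γ^(1/2)` and summing one
factor over all blocks bounds the total disturbance (`norm_blockProj_sub_le`).

A hypercyclic orbit is unbounded in each block, so blocks of higher level must carry arbitrarily
large masses (`exists_lt_blockMass`). Always taking the first time at which such a mass shows up
produces leading blocks `l_i`, with increasing levels, non-decreasing masses `Y_i` and arrival times
`t_i`, such that block `l_i` is disturbed by at most `Y_i / 4` before `t_{i+1}`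
(`IsLeading.exists_next`). By a Markov argument (`card_small_le`), the rotation keeps the block norm
at least `Y_i / 2` for most times in `[t_i, t_{i+1})`, hence `‖T ^ j x‖ ≥ Y_i / 4 ≥ Y_0 / 4` there.

The exceptional times are rare for two reasons (`card_norm_lt_le`): early in a phase there are
`O(δ)` of them, against `t_i ≥ η`; later their proportion is of order `(4δ + η) / Δ`.
`tendsto_ncard_div_zero` glues the phases together. -/

theorem norm_basisVec (p : ℝ≥0∞) [Fact (1 ≤ p)] (k : ℕ) : ‖basisVec p k‖ = 1 := by
  rw [basisVec, lp.norm_single (zero_lt_one.trans_le Fact.out)]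
  simp

/-! ### Orbits of the first vectors of the blocks -/

namespace CTypeParams

variable {p : ℝ≥0∞} [Fact (1 ≤ p)]

/-- The length of the block number `n`. -/
def blockLen (P : CTypeParams) (n : ℕ) : ℕ := P.b (n + 1) - P.b n

/-- The product of the first `i` weights of the block number `n`. -/
noncomputable def blockCoeff (P : CTypeParams) (n i : ℕ) : ℂ :=
  ∏ s ∈ Finset.range i, P.w (P.b n + s + 1)

theorem blockLen_pos (P : CTypeParams) (n : ℕ) : 0 < P.blockLen n :=
  Nat.sub_pos_of_lt (P.b_strictMono n.lt_succ_self)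

theorem b_add_blockLen (P : CTypeParams) (n : ℕ) : P.b n + P.blockLen n = P.b (n + 1) :=
  Nat.add_sub_of_le (P.b_strictMono n.lt_succ_self).le

theorem w_ne_zero (P : CTypeParams) {k : ℕ} (hk : 1 ≤ k) : P.w k ≠ 0 := by
  obtain ⟨c, hc, h⟩ := P.w_bounded_below
  exact norm_pos_iff.1 (hc.trans_le (h k hk))

theorem W_ne_zero (P : CTypeParams) (n : ℕ) : P.W n ≠ 0 := by
  obtain ⟨c, hc, h⟩ := P.W_bounded_below
  exact norm_pos_iff.1 (hc.trans_le (h n))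

theorem blockCoeff_ne_zero (P : CTypeParams) (n i : ℕ) : P.blockCoeff n i ≠ 0 :=
  Finset.prod_ne_zero_iff.2 fun _ _ => P.w_ne_zero (by omega)

theorem blockCoeff_zero (P : CTypeParams) (n : ℕ) : P.blockCoeff n 0 = 1 := by
  simp [blockCoeff]

theorem blockCoeff_succ (P : CTypeParams) (n i : ℕ) :
    P.blockCoeff n (i + 1) = P.blockCoeff n i * P.w (P.b n + i + 1) := by
  simp [blockCoeff, Finset.prod_range_succ]

theorem blockCoeff_last (P : CTypeParams) (n : ℕ) :
    P.blockCoeff n (P.blockLen n - 1) = P.W n := by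
  have h0 := P.b_strictMono n.lt_succ_self
  have : Finset.Ioo (P.b n) (P.b (n + 1)) = Finset.Ico (P.b n + 1) (P.b (n + 1)) := by
    ext j
    simp
  rw [W, this, Finset.prod_Ico_eq_prod_range, blockCoeff, blockLen]
  refine Finset.prod_congr ?_ fun s _ => ?_
  · congr 1
  · congr 1
    omega

theorem IsOperator.pow_basisVec {P : CTypeParams} {T : SeqSpace p →L[ℂ] SeqSpace p}
    (hT : P.IsOperator T) (n : ℕ) {i : ℕ} (hi : i < P.blockLen n) :
    (T ^ i) (basisVec p (P.b n)) = P.blockCoeff n i • basisVec p (P.b n + i) := by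
  induction i with
  | zero => simp [blockCoeff_zero]
  | succ i ih =>
    have h1 := P.b_add_blockLen n
    rw [pow_succ', mul_apply_eq_comp, ih (by omega), map_smul,
      hT.shift n _ (by omega) (by omega), smul_smul, blockCoeff_succ]
    rfl

theorem IsOperator.pow_blockLen {P : CTypeParams} {T : SeqSpace p →L[ℂ] SeqSpace p}
    (hT : P.IsOperator T) {n : ℕ} (hn : 1 ≤ n) :
    (T ^ P.blockLen n) (basisVec p (P.b n)) =
      (P.W n * P.v n) • basisVec p (P.b (P.φ n)) - basisVec p (P.b n) := by
  have h0 := P.blockLen_pos n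
  have h1 := P.b_add_blockLen n
  obtain ⟨m, hm⟩ : ∃ m, P.blockLen n = m + 1 := ⟨P.blockLen n - 1, by omega⟩
  have h2 : P.b n + m = P.b (n + 1) - 1 := by omega
  have h3 := P.blockCoeff_last n
  rw [hm, Nat.add_sub_cancel] at h3
  rw [hm, pow_succ', mul_apply_eq_comp, hT.pow_basisVec n (by omega), map_smul, h2,
    hT.last n hn, h3, smul_sub, smul_smul, smul_smul, mul_inv_cancel₀ (P.W_ne_zero n), one_smul]

theorem IsOperator.pow_blockLen_zero {P : CTypeParams} {T : SeqSpace p →L[ℂ] SeqSpace p}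
    (hT : P.IsOperator T) :
    (T ^ P.blockLen 0) (basisVec p (P.b 0)) = -basisVec p (P.b 0) := by
  have h0 := P.blockLen_pos 0
  have h1 := P.b_add_blockLen 0
  obtain ⟨m, hm⟩ : ∃ m, P.blockLen 0 = m + 1 := ⟨P.blockLen 0 - 1, by omega⟩
  have h2 : P.b 0 + m = P.b 1 - 1 := by simp only [zero_add] at h1; omega
  have h3 := P.blockCoeff_last 0
  rw [hm, Nat.add_sub_cancel] at h3
  rw [hm, pow_succ', mul_apply_eq_comp, hT.pow_basisVec 0 (by omega), map_smul, h2,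
    hT.last_zero, h3, smul_smul, mul_neg, mul_inv_cancel₀ (P.W_ne_zero 0), neg_one_smul, P.b_zero]

theorem pow_mul_apply_of_fixed {E : Type*} [NormedAddCommGroup E] [NormedSpace ℂ E]
    (T : E →L[ℂ] E) {x : E} {a : ℕ} (h : (T ^ a) x = x) (m : ℕ) : (T ^ (a * m)) x = x := by
  induction m with
  | zero => simp
  | succ m ih => rw [Nat.mul_succ, pow_add, mul_apply_eq_comp, h, ih]

/-- By `b_dvd` the length of block `n` is a multiple of twice that of block `φ n`, so by induction
`T ^ blockLen n` fixes `e_{b_{φ n}}`. The two `v_n` terms then cancel, and the two signs `-1`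
multiply to `1`. -/
theorem IsOperator.pow_two_mul_blockLen {P : CTypeParams} {T : SeqSpace p →L[ℂ] SeqSpace p}
    (hT : P.IsOperator T) (n : ℕ) :
    (T ^ (2 * P.blockLen n)) (basisVec p (P.b n)) = basisVec p (P.b n) := by
  induction n using Nat.strong_induction_on with
  | _ n ih =>
    rw [two_mul, pow_add, mul_apply_eq_comp]
    rcases Nat.eq_zero_or_pos n with rfl | hn
    · rw [hT.pow_blockLen_zero, map_neg, hT.pow_blockLen_zero, neg_neg]
    · obtain ⟨d, hd⟩ := P.b_dvd n hn
      have h1 : (T ^ P.blockLen n) (basisVec p (P.b (P.φ n))) = basisVec p (P.b (P.φ n)) := by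
        have := pow_mul_apply_of_fixed T (ih _ (P.φ_lt n hn)) d
        rwa [blockLen, ← hd] at this
      rw [hT.pow_blockLen hn, map_sub, map_smul, h1, hT.pow_blockLen hn]
      abel

theorem IsOperator.pow_eq_pow_mod {P : CTypeParams} {T : SeqSpace p →L[ℂ] SeqSpace p}
    (hT : P.IsOperator T) (n m : ℕ) :
    (T ^ m) (basisVec p (P.b n)) = (T ^ (m % (2 * P.blockLen n))) (basisVec p (P.b n)) := by
  conv_lhs => rw [← Nat.mod_add_div m (2 * P.blockLen n)]
  rw [pow_add, mul_apply_eq_comp,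
    pow_mul_apply_of_fixed T (hT.pow_two_mul_blockLen n)]

/-- The powers of `T` along the orbit of the first vector of a block. -/
theorem IsOperator.pow_cases {P : CTypeParams} {T : SeqSpace p →L[ℂ] SeqSpace p}
    (hT : P.IsOperator T) {n : ℕ} (hn : 1 ≤ n) (m : ℕ) :
    (T ^ m) (basisVec p (P.b n)) =
        P.blockCoeff n (m % P.blockLen n) • basisVec p (P.b n + m % P.blockLen n) ∨
    (P.blockLen n ≤ m ∧ ∃ m', (T ^ m) (basisVec p (P.b n)) =
        (P.W n * P.v n) • (T ^ m') (basisVec p (P.b (P.φ n))) -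
        P.blockCoeff n (m % P.blockLen n) • basisVec p (P.b n + m % P.blockLen n)) := by
  have h0 := P.blockLen_pos n
  set L := P.blockLen n with hL
  have hmod : m % (2 * L) % L = m % L := Nat.mod_mul_left_mod m 2 L
  have hlt : m % (2 * L) < 2 * L := Nat.mod_lt _ (by omega)
  have hle : m % (2 * L) ≤ m := Nat.mod_le _ _
  rw [hT.pow_eq_pow_mod n m, ← hL]
  set r := m % (2 * L)
  rw [← hmod]
  -- The first half of the period only runs through the block; the second half carries the sign `-1`
  -- and the `v_n` term.
  rcases lt_or_ge r L with h | h
  · left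
    rw [Nat.mod_eq_of_lt h, hT.pow_basisVec n h]
  · right
    refine ⟨by omega, r - L, ?_⟩
    have h2 : r % L = r - L := by
      rw [Nat.mod_eq_sub_mod h, Nat.mod_eq_of_lt (by omega)]
    have h3 : r = (r - L) + L := by omega
    rw [h2]
    conv_lhs => rw [h3]
    rw [pow_add, mul_apply_eq_comp, hT.pow_blockLen hn, map_sub, map_smul,
      hT.pow_basisVec n (by omega)]

theorem IsOperator.pow_cases_zero {P : CTypeParams} {T : SeqSpace p →L[ℂ] SeqSpace p}
    (hT : P.IsOperator T) (m : ℕ) :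
    ∃ i < P.blockLen 0, ∃ c : ℂ, (T ^ m) (basisVec p (P.b 0)) = c • basisVec p (P.b 0 + i) := by
  have h0 := P.blockLen_pos 0
  rw [hT.pow_eq_pow_mod 0 m]
  have hlt : m % (2 * P.blockLen 0) < 2 * P.blockLen 0 := Nat.mod_lt _ (by omega)
  set r := m % (2 * P.blockLen 0)
  rcases lt_or_ge r (P.blockLen 0) with h | h
  · exact ⟨r, h, _, hT.pow_basisVec 0 h⟩
  · refine ⟨r - P.blockLen 0, by omega, -P.blockCoeff 0 (r - P.blockLen 0), ?_⟩
    have h3 : r = (r - P.blockLen 0) + P.blockLen 0 := by omega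
    conv_lhs => rw [h3]
    rw [pow_add, mul_apply_eq_comp, hT.pow_blockLen_zero, map_neg,
      hT.pow_basisVec 0 (by omega), neg_smul]

/-! ### Block projections -/

theorem exists_blockProj (P : CTypeParams) (hp : p ≠ ∞) (l : ℕ) :
    ∃ D : SeqSpace p →L[ℂ] SeqSpace p, ∀ x j,
      D x j = (if P.b l ≤ j ∧ j < P.b (l + 1) then 1 else 0) * x j :=
  exists_weightedComp hp id Function.injective_id
    (fun j => if P.b l ≤ j ∧ j < P.b (l + 1) then 1 else 0) 1 fun j => by
      split_ifs <;> simp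

/-- The projection of `ℓ^p(ℕ)` onto the coordinates in the block number `l`. -/
noncomputable def blockProj (P : CTypeParams) (hp : p ≠ ∞) (l : ℕ) :
    SeqSpace p →L[ℂ] SeqSpace p := (P.exists_blockProj hp l).choose

theorem blockProj_apply (P : CTypeParams) (hp : p ≠ ∞) (l : ℕ) (x : SeqSpace p) (j : ℕ) :
    P.blockProj hp l x j = (if P.b l ≤ j ∧ j < P.b (l + 1) then 1 else 0) * x j :=
  (P.exists_blockProj hp l).choose_spec x j

theorem norm_blockProj_le (P : CTypeParams) (hp : p ≠ ∞) (l : ℕ) (x : SeqSpace p) :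
    ‖P.blockProj hp l x‖ ≤ ‖x‖ := by
  have hp0 : 0 < p.toReal :=
    ENNReal.toReal_pos (zero_lt_one.trans_le Fact.out).ne' hp
  refine lp.norm_le_of_forall_sum_le hp0 (norm_nonneg _) fun s => ?_
  refine le_trans (Finset.sum_le_sum fun j _ => ?_) (lp.sum_rpow_le_norm_rpow hp0 x s)
  refine Real.rpow_le_rpow (norm_nonneg _) ?_ hp0.le
  rw [blockProj_apply]
  split_ifs <;> simp

theorem blockProj_basisVec_self (P : CTypeParams) (hp : p ≠ ∞) (l : ℕ) {i : ℕ}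
    (hi : i < P.blockLen l) :
    P.blockProj hp l (basisVec p (P.b l + i)) = basisVec p (P.b l + i) := by
  have h1 := P.b_add_blockLen l
  ext j
  rw [blockProj_apply]
  by_cases h : j = P.b l + i
  · subst h
    rw [if_pos (by omega), one_mul]
  · simp [basisVec, h]

theorem blockProj_basisVec_of_ne (P : CTypeParams) (hp : p ≠ ∞) {l n : ℕ} (hln : l ≠ n) {i : ℕ}
    (hi : i < P.blockLen n) :
    P.blockProj hp l (basisVec p (P.b n + i)) = 0 := by
  have h1 := P.b_add_blockLen n
  ext j
  rw [blockProj_apply]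
  by_cases h : j = P.b n + i
  · subst h
    rw [if_neg, zero_mul]
    · rfl
    · rintro ⟨h2, h3⟩
      have h4 : l < n + 1 := P.b_strictMono.lt_iff_lt.1 (by omega)
      have h5 : n < l + 1 := P.b_strictMono.lt_iff_lt.1 (by omega)
      omega
  · simp [basisVec, h]

end CTypeParams

/-! ### Weight products and levels in the C⁺ case -/

/-- The exponent `g` such that the product of the first `i` block weights is `2 ^ (-g)`. -/
def blockDip (Δ δ η i : ℕ) : ℕ :=
  if i ≤ δ then i
  else if i ≤ 2 * δ then 2 * δ - i
  else if i + 2 * δ + 2 * η < Δ then 0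
  else if i + δ + 2 * η < Δ then i + 1 + 2 * δ + 2 * η - Δ
  else if i + δ + η < Δ then δ
  else if i + η < Δ then Δ - η - 1 - i
  else 0

theorem pow_blockDip_succ {Δ δ η i : ℕ} (h : 4 * δ + 2 * η < Δ) (hi : i + 1 < Δ) :
    (1 / 2 : ℂ) ^ blockDip Δ δ η (i + 1) =
      (1 / 2 : ℂ) ^ blockDip Δ δ η i * blockWeight Δ δ η (i + 1) := by
  have key : (blockWeight Δ δ η (i + 1) = 1 / 2 ∧
        blockDip Δ δ η (i + 1) = blockDip Δ δ η i + 1) ∨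
      (blockWeight Δ δ η (i + 1) = 2 ∧ blockDip Δ δ η i = blockDip Δ δ η (i + 1) + 1) ∨
      (blockWeight Δ δ η (i + 1) = 1 ∧ blockDip Δ δ η i = blockDip Δ δ η (i + 1)) := by
    unfold blockWeight
    by_cases h1 : i + 1 ≤ δ
    · left
      refine ⟨if_pos h1, ?_⟩
      unfold blockDip
      split_ifs <;> omega
    rw [if_neg h1]
    by_cases h2 : i + 1 ≤ 2 * δ
    · right; left
      refine ⟨if_pos h2, ?_⟩
      unfold blockDip
      split_ifs <;> omega
    rw [if_neg h2]
    by_cases h3 : i + 1 + 2 * δ + 2 * η < Δ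
    · right; right
      refine ⟨if_pos h3, ?_⟩
      unfold blockDip
      split_ifs <;> omega
    rw [if_neg h3]
    by_cases h4 : i + 1 + δ + 2 * η < Δ
    · left
      refine ⟨if_pos h4, ?_⟩
      unfold blockDip
      split_ifs <;> omega
    rw [if_neg h4]
    by_cases h5 : i + 1 + δ + η < Δ
    · right; right
      refine ⟨if_pos h5, ?_⟩
      unfold blockDip
      split_ifs <;> omega
    rw [if_neg h5]
    by_cases h6 : i + 1 + η < Δ
    · right; left
      refine ⟨if_pos h6, ?_⟩
      unfold blockDip
      split_ifs <;> omega
    · right; right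
      refine ⟨if_neg h6, ?_⟩
      unfold blockDip
      split_ifs <;> omega
  rcases key with ⟨h1, h2⟩ | ⟨h1, h2⟩ | ⟨h1, h2⟩
  · rw [h1, h2, pow_succ]
  · rw [h1, h2, pow_succ, mul_assoc]
    norm_num
  · rw [h1, h2, mul_one]

/-- The number `k ≥ 1` with `n ∈ [2^(k-1), 2^k)`, for `n ≥ 1`. -/
def blockLevel (n : ℕ) : ℕ := Nat.log 2 n + 1

theorem one_le_blockLevel (n : ℕ) : 1 ≤ blockLevel n := Nat.le_add_left _ _

theorem pow_blockLevel_le {n : ℕ} (hn : 1 ≤ n) : 2 ^ (blockLevel n - 1) ≤ n :=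
  Nat.pow_log_le_self 2 (by omega)

theorem lt_pow_blockLevel (n : ℕ) : n < 2 ^ blockLevel n :=
  Nat.lt_pow_succ_log_self (by norm_num) n

theorem blockLevel_mono {m n : ℕ} (h : m ≤ n) : blockLevel m ≤ blockLevel n :=
  Nat.add_le_add_right (Nat.log_mono_right h) 1

namespace IsSpecialCPlus

variable {p : ℝ≥0∞} [Fact (1 ≤ p)] {P : CTypeParams} {Δ τ δ η : ℕ → ℕ}

theorem blockLen_eq (hP : IsSpecialCPlus P Δ τ δ η) {n : ℕ} (hn : 1 ≤ n) :
    P.blockLen n = Δ (blockLevel n) :=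
  hP.isCPlus.size_eq _ (one_le_blockLevel n) n (pow_blockLevel_le hn) (lt_pow_blockLevel n)

theorem φ_eq (hP : IsSpecialCPlus P Δ τ δ η) {n : ℕ} (hn : 1 ≤ n) :
    P.φ n = n - 2 ^ (blockLevel n - 1) :=
  hP.isCPlus.φ_eq _ (one_le_blockLevel n) n (pow_blockLevel_le hn) (lt_pow_blockLevel n)

theorem φ_lt_pow (hP : IsSpecialCPlus P Δ τ δ η) {n : ℕ} (hn : 1 ≤ n) :
    P.φ n < 2 ^ (blockLevel n - 1) := by
  have h1 := hP.φ_eq hn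
  have h2 := lt_pow_blockLevel n
  have h3 := one_le_blockLevel n
  obtain ⟨k, hk⟩ : ∃ k, blockLevel n = k + 1 := ⟨blockLevel n - 1, by omega⟩
  rw [hk, pow_succ] at h2
  rw [hk, Nat.add_sub_cancel] at h1 ⊢
  omega

theorem norm_v (hP : IsSpecialCPlus P Δ τ δ η) {n : ℕ} (hn : 1 ≤ n) :
    ‖P.v n‖ = (2 : ℝ) ^ (-(τ (blockLevel n) : ℤ)) := by
  rw [hP.isCPlus.v_eq _ (one_le_blockLevel n) n (pow_blockLevel_le hn) (lt_pow_blockLevel n),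
    norm_zpow]
  norm_num

theorem norm_v_le_one (hP : IsSpecialCPlus P Δ τ δ η) {n : ℕ} (hn : 1 ≤ n) : ‖P.v n‖ ≤ 1 := by
  rw [hP.norm_v hn]
  exact zpow_le_one_of_nonpos₀ (by norm_num) (by simp)

theorem blockCoeff_eq (hP : IsSpecialCPlus P Δ τ δ η) {n i : ℕ} (hn : 1 ≤ n)
    (hi : i < P.blockLen n) :
    P.blockCoeff n i = (1 / 2 : ℂ) ^
      blockDip (Δ (blockLevel n)) (δ (blockLevel n)) (η (blockLevel n)) i := by
  rw [hP.blockLen_eq hn] at hi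
  induction i with
  | zero => simp [P.blockCoeff_zero, blockDip]
  | succ i ih =>
    rw [P.blockCoeff_succ, ih (by omega),
      pow_blockDip_succ (hP.lt_Δ _ (one_le_blockLevel n)) hi, add_assoc,
      hP.isCPlus.w_eq _ (one_le_blockLevel n) n (pow_blockLevel_le hn) (lt_pow_blockLevel n)
        (i + 1) (by omega) hi]

theorem norm_blockCoeff_le_one (hP : IsSpecialCPlus P Δ τ δ η) {n i : ℕ} (hn : 1 ≤ n)
    (hi : i < P.blockLen n) : ‖P.blockCoeff n i‖ ≤ 1 := by
  rw [hP.blockCoeff_eq hn hi, norm_pow]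
  exact pow_le_one₀ (norm_nonneg _) (by norm_num)

/-- The products drop below `1` only in a triangular dip of width `2δ` at the start and in a
trapezoidal dip beginning at `Δ - 2δ - 2η`. The factors `2` have undone the factors `1/2` by the
index `Δ - η - 1`, so the last `η + 1` positions are flat. -/
theorem blockCoeff_eq_one (hP : IsSpecialCPlus P Δ τ δ η) {n i : ℕ} (hn : 1 ≤ n)
    (hi : i < P.blockLen n)
    (h : (2 * δ (blockLevel n) ≤ i ∧ i + 2 * δ (blockLevel n) + 2 * η (blockLevel n) <
        P.blockLen n) ∨ P.blockLen n ≤ i + η (blockLevel n) + 1) : P.blockCoeff n i = 1 := by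
  rw [hP.blockCoeff_eq hn hi]
  have h1 := hP.lt_Δ _ (one_le_blockLevel n)
  have h2 := hP.δ_pos _ (one_le_blockLevel n)
  rw [hP.blockLen_eq hn] at h hi
  have : blockDip (Δ (blockLevel n)) (δ (blockLevel n)) (η (blockLevel n)) i = 0 := by
    unfold blockDip
    split_ifs <;> omega
  rw [this, pow_zero]

theorem W_eq_one (hP : IsSpecialCPlus P Δ τ δ η) {n : ℕ} (hn : 1 ≤ n) : P.W n = 1 := by
  have h := P.blockLen_pos n
  rw [← P.blockCoeff_last, hP.blockCoeff_eq_one hn (by omega) (by omega)]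

/-! ### Influence of one block on another -/

variable {T : SeqSpace p →L[ℂ] SeqSpace p}

/-- The orbit of `e_{b_n}` only meets the blocks `n`, `φ n`, `φ (φ n)`, and so on. Past `n` these
indices lie below `2 ^ (blockLevel l - 1) ≤ l`, so the chain never meets `l`. -/
theorem blockProj_pow_eq_zero (hP : IsSpecialCPlus P Δ τ δ η) (hp : p ≠ ∞) (hT : P.IsOperator T)
    {l : ℕ} (hl : 1 ≤ l) {n : ℕ} (hln : l ≠ n) (hlev : blockLevel n ≤ blockLevel l) (m : ℕ) :
    P.blockProj hp l ((T ^ m) (basisVec p (P.b n))) = 0 := by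
  induction n using Nat.strong_induction_on generalizing m with
  | _ n ih =>
    rcases Nat.eq_zero_or_pos n with rfl | hn
    · obtain ⟨i, hi, c, hc⟩ := hT.pow_cases_zero m
      rw [hc, map_smul, P.blockProj_basisVec_of_ne hp hln hi, smul_zero]
    · have hr : m % P.blockLen n < P.blockLen n := Nat.mod_lt _ (P.blockLen_pos n)
      rcases hT.pow_cases hn m with h | ⟨-, m', h⟩
      · rw [h, map_smul, P.blockProj_basisVec_of_ne hp hln hr, smul_zero]
      · have h1 := hP.φ_lt_pow hn
        have h2 := pow_blockLevel_le hl
        have h3 : 2 ^ (blockLevel n - 1) ≤ 2 ^ (blockLevel l - 1) :=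
          Nat.pow_le_pow_right (by norm_num) (by omega)
        rw [h, map_sub, map_smul, map_smul, P.blockProj_basisVec_of_ne hp hln hr,
          ih _ (P.φ_lt n hn) (by omega) ((blockLevel_mono (P.φ_lt n hn).le).trans hlev)]
        simp

/-- Passing from block `n` to block `φ n` costs the factor `v_n`, because `W_n = 1`, and all weight
products are at most `1`. The two bounds go together: the second one for `n` uses the first one for
`φ n`. -/
theorem norm_blockProj_pow_le (hP : IsSpecialCPlus P Δ τ δ η) (hp : p ≠ ∞) (hT : P.IsOperator T)
    {l : ℕ} (hl : 1 ≤ l) (n m : ℕ) :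
    ‖P.blockProj hp l ((T ^ m) (basisVec p (P.b n)))‖ ≤ 1 ∧
      (1 ≤ n → l ≠ n →
        ‖P.blockProj hp l ((T ^ m) (basisVec p (P.b n)))‖ ≤ ‖P.v n‖) := by
  induction n using Nat.strong_induction_on generalizing m with
  | _ n ih =>
    rcases Nat.eq_zero_or_pos n with rfl | hn
    -- Since `Nat.log 2 0 = 0`, block `0` has level `1` and is never of higher level than `l`.
    · have h := hP.blockProj_pow_eq_zero hp hT hl (n := 0) (by omega)
        (blockLevel_mono (Nat.zero_le l)) m
      rw [h]
      simp
    · have hr : m % P.blockLen n < P.blockLen n := Nat.mod_lt _ (P.blockLen_pos n)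
      have hc := hP.norm_blockCoeff_le_one hn hr
      have hv := hP.norm_v_le_one hn
      by_cases hln : l = n
      · subst hln
        refine ⟨?_, fun _ h => absurd rfl h⟩
        have hφ : l ≠ P.φ l := (P.φ_lt l hl).ne'
        rcases hT.pow_cases hn m with h | ⟨-, m', h⟩
        · rw [h, map_smul, P.blockProj_basisVec_self hp l hr, norm_smul, norm_basisVec, mul_one]
          exact hc
        · rw [h, map_sub, map_smul, map_smul, P.blockProj_basisVec_self hp l hr,
            hP.blockProj_pow_eq_zero hp hT hl hφ (blockLevel_mono (P.φ_lt l hl).le),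
            smul_zero, zero_sub, norm_neg, norm_smul, norm_basisVec, mul_one]
          exact hc
      · have key : ‖P.blockProj hp l ((T ^ m) (basisVec p (P.b n)))‖ ≤ ‖P.v n‖ := by
          rcases hT.pow_cases hn m with h | ⟨-, m', h⟩
          · rw [h, map_smul, P.blockProj_basisVec_of_ne hp hln hr, smul_zero, norm_zero]
            exact norm_nonneg _
          · rw [h, map_sub, map_smul, map_smul, P.blockProj_basisVec_of_ne hp hln hr, smul_zero,
              sub_zero, hP.W_eq_one hn, one_mul, norm_smul]
            exact mul_le_of_le_one_right (norm_nonneg _) (ih _ (P.φ_lt n hn) m').1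
        exact ⟨key.trans hv, fun _ _ => key⟩

theorem blockProj_pow_eq_zero_of_lt (hp : p ≠ ∞)
    (hT : P.IsOperator T) {l n : ℕ} (hln : l ≠ n) {m : ℕ} (hm : m < P.blockLen n) :
    P.blockProj hp l ((T ^ m) (basisVec p (P.b n))) = 0 := by
  rw [hT.pow_basisVec n hm, map_smul, P.blockProj_basisVec_of_ne hp hln hm, smul_zero]

/-- The `v_n` term lives on blocks reached from `φ n`, none of which is `n`; what remains is a
rotation with a sign. -/
theorem blockProj_pow_self (hP : IsSpecialCPlus P Δ τ δ η) (hp : p ≠ ∞) (hT : P.IsOperator T)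
    {n : ℕ} (hn : 1 ≤ n) (m : ℕ) :
    ∃ s : ℂ, ‖s‖ = 1 ∧ P.blockProj hp n ((T ^ m) (basisVec p (P.b n))) =
      (s * P.blockCoeff n (m % P.blockLen n)) • basisVec p (P.b n + m % P.blockLen n) := by
  have hr : m % P.blockLen n < P.blockLen n := Nat.mod_lt _ (P.blockLen_pos n)
  have hφ : n ≠ P.φ n := (P.φ_lt n hn).ne'
  rcases hT.pow_cases hn m with h | ⟨-, m', h⟩
  · exact ⟨1, by simp, by rw [h, map_smul, P.blockProj_basisVec_self hp n hr, one_mul]⟩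
  · refine ⟨-1, by simp, ?_⟩
    rw [h, map_sub, map_smul, map_smul, P.blockProj_basisVec_self hp n hr,
      hP.blockProj_pow_eq_zero hp hT hn hφ (blockLevel_mono (P.φ_lt n hn).le)]
    simp

end IsSpecialCPlus

/-! ### Block decomposition and block masses -/

theorem one_le_toReal {p : ℝ≥0∞} [Fact (1 ≤ p)] (hp : p ≠ ∞) : 1 ≤ p.toReal := by
  have := (ENNReal.toReal_le_toReal ENNReal.one_ne_top hp).2 (Fact.out : 1 ≤ p)
  simpa using this

/-- Hölder's inequality; it is the source of the factor `Δ ^ (1 - 1/p)` in `gammaSeq`. -/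
theorem sum_le_card_rpow_mul {ι : Type*} (s : Finset ι) (f : ι → ℝ) (hf : ∀ i ∈ s, 0 ≤ f i)
    {q : ℝ} (hq : 1 ≤ q) :
    ∑ i ∈ s, f i ≤ (s.card : ℝ) ^ (1 - 1 / q) * (∑ i ∈ s, f i ^ q) ^ (1 / q) := by
  have hq0 : 0 < q := by linarith
  have h0 : 0 ≤ ∑ i ∈ s, f i ^ q := Finset.sum_nonneg fun i hi => Real.rpow_nonneg (hf i hi) _
  have h := Real.rpow_le_rpow (Real.rpow_nonneg (Finset.sum_nonneg hf) _)
    (Real.rpow_sum_le_const_mul_sum_rpow_of_nonneg s hq hf) (by positivity : (0 : ℝ) ≤ 1 / q)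
  rw [← Real.rpow_mul (Finset.sum_nonneg hf), mul_one_div_cancel hq0.ne', Real.rpow_one,
    Real.mul_rpow (by positivity) h0, ← Real.rpow_mul (by positivity)] at h
  convert h using 3
  field_simp

namespace CTypeParams

variable {p : ℝ≥0∞}

/-- The coordinates of `x` in the block number `n`, relative to the vectors `T ^ i e_{b_n}`. -/
noncomputable def orbitCoord (P : CTypeParams) (n : ℕ) (x : SeqSpace p) (i : ℕ) : ℂ :=
  x (P.b n + i) / P.blockCoeff n i

/-- The `ℓ^p`-norm of the last `t` orbit coordinates of the block number `n`. -/
noncomputable def blockMass (P : CTypeParams) (n t : ℕ) (x : SeqSpace p) : ℝ :=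
  (∑ i ∈ Finset.Ico (P.blockLen n - t) (P.blockLen n),
    ‖P.orbitCoord n x i‖ ^ p.toReal) ^ (1 / p.toReal)

/-- The part of `x` supported by the block number `n`. -/
noncomputable def blockPart (P : CTypeParams) (n : ℕ) (x : SeqSpace p) : SeqSpace p :=
  ∑ i ∈ Finset.range (P.blockLen n), x (P.b n + i) • basisVec p (P.b n + i)

theorem blockMass_nonneg (P : CTypeParams) (n t : ℕ) (x : SeqSpace p) :
    0 ≤ P.blockMass n t x :=
  Real.rpow_nonneg (Finset.sum_nonneg fun _ _ => Real.rpow_nonneg (norm_nonneg _) _) _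

theorem sum_blockPart (P : CTypeParams) (x : SeqSpace p) (M : ℕ) :
    ∑ n ∈ Finset.range M, P.blockPart n x =
      ∑ k ∈ Finset.range (P.b M), x k • basisVec p k := by
  induction M with
  | zero => simp [P.b_zero]
  | succ M ih =>
    rw [Finset.sum_range_succ, ih, ← P.b_add_blockLen M, Finset.sum_range_add]
    rfl

variable [Fact (1 ≤ p)]

theorem blockMass_rpow (P : CTypeParams) (hp : p ≠ ∞) (n t : ℕ) (x : SeqSpace p) :
    P.blockMass n t x ^ p.toReal = ∑ i ∈ Finset.Ico (P.blockLen n - t) (P.blockLen n),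
      ‖P.orbitCoord n x i‖ ^ p.toReal := by
  have hq := one_le_toReal hp
  rw [blockMass, ← Real.rpow_mul
    (Finset.sum_nonneg fun _ _ => Real.rpow_nonneg (norm_nonneg _) _),
    one_div_mul_cancel (by linarith), Real.rpow_one]

theorem IsOperator.blockPart_eq {P : CTypeParams} {T : SeqSpace p →L[ℂ] SeqSpace p}
    (hT : P.IsOperator T) (n : ℕ) (x : SeqSpace p) :
    P.blockPart n x = ∑ i ∈ Finset.range (P.blockLen n),
      P.orbitCoord n x i • (T ^ i) (basisVec p (P.b n)) := by
  refine Finset.sum_congr rfl fun i hi => ?_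
  rw [hT.pow_basisVec n (Finset.mem_range.1 hi), smul_smul, orbitCoord,
    div_mul_cancel₀ _ (P.blockCoeff_ne_zero n i)]

theorem IsOperator.blockProj_pow_blockPart {P : CTypeParams} {T : SeqSpace p →L[ℂ] SeqSpace p}
    (hT : P.IsOperator T) (hp : p ≠ ∞) (l n j : ℕ) (x : SeqSpace p) :
    P.blockProj hp l ((T ^ j) (P.blockPart n x)) = ∑ i ∈ Finset.range (P.blockLen n),
      P.orbitCoord n x i • P.blockProj hp l ((T ^ (i + j)) (basisVec p (P.b n))) := by
  rw [hT.blockPart_eq, map_sum, map_sum]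
  refine Finset.sum_congr rfl fun i _ => ?_
  rw [map_smul, map_smul, add_comm, pow_add, mul_apply_eq_comp]

theorem tendsto_sum_blockPart (P : CTypeParams) (hp : p ≠ ∞) (x : SeqSpace p) :
    Tendsto (fun M => ∑ n ∈ Finset.range M, P.blockPart n x) atTop (𝓝 x) := by
  have h := (lp.hasSum_single hp x).tendsto_sum_nat.comp P.b_strictMono.tendsto_atTop
  refine h.congr fun M => ?_
  rw [P.sum_blockPart, Function.comp_apply]
  refine Finset.sum_congr rfl fun k _ => ?_
  rw [basisVec, ← lp.single_smul]
  simp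

end CTypeParams

theorem gammaSeq_nonneg (p : ℝ≥0∞) (τ Δ : ℕ → ℕ) (k : ℕ) : 0 ≤ gammaSeq p τ Δ k := by
  unfold gammaSeq
  positivity

theorem sum_Ico_blockLevel (g : ℕ → ℝ) (K : ℕ) :
    ∑ n ∈ Finset.Ico 1 (2 ^ K), g (blockLevel n) =
      ∑ k ∈ Finset.range K, (2 : ℝ) ^ k * g (k + 1) := by
  induction K with
  | zero => simp
  | succ K ih =>
    rw [← Finset.sum_Ico_consecutive _ (Nat.one_le_two_pow (n := K))
      (Nat.pow_le_pow_right (by norm_num) K.le_succ), ih, Finset.sum_range_succ]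
    congr 1
    have : ∀ n ∈ Finset.Ico (2 ^ K) (2 ^ (K + 1)), g (blockLevel n) = g (K + 1) := by
      intro n hn
      rw [Finset.mem_Ico] at hn
      rw [blockLevel, Nat.log_eq_of_pow_le_of_lt_pow hn.1 hn.2]
    rw [Finset.sum_congr rfl this, Finset.sum_const, Nat.card_Ico, nsmul_eq_mul, pow_succ,
      Nat.cast_sub (by omega)]
    push_cast
    ring

/-- Level `k + 1` contains `2 ^ k` blocks, half of the weight `2 ^ (k + 1)`; hence `1 / 2`. -/
theorem sum_sqrt_gammaSeq_le {p : ℝ≥0∞} {τ Δ : ℕ → ℕ}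
    (hs : Summable fun k : ℕ => (2 : ℝ) ^ (k + 1) * gammaSeq p τ Δ (k + 1) ^ (1 / 2 : ℝ))
    (h : ∑' k : ℕ, (2 : ℝ) ^ (k + 1) * gammaSeq p τ Δ (k + 1) ^ (1 / 2 : ℝ) ≤ 1)
    {s : Finset ℕ} (hs0 : 0 ∉ s) :
    ∑ n ∈ s, gammaSeq p τ Δ (blockLevel n) ^ (1 / 2 : ℝ) ≤ 1 / 2 := by
  have h0 : ∀ k, 0 ≤ gammaSeq p τ Δ k ^ (1 / 2 : ℝ) := fun k =>
    Real.rpow_nonneg (gammaSeq_nonneg p τ Δ k) _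
  set K := s.sup id
  calc ∑ n ∈ s, gammaSeq p τ Δ (blockLevel n) ^ (1 / 2 : ℝ)
      ≤ ∑ n ∈ Finset.Ico 1 (2 ^ K), gammaSeq p τ Δ (blockLevel n) ^ (1 / 2 : ℝ) := by
        refine Finset.sum_le_sum_of_subset_of_nonneg (fun n hn => ?_) fun n _ _ => h0 _
        have h1 : n ≤ K := Finset.le_sup (f := id) hn
        have h2 : n ≠ 0 := fun h => hs0 (h ▸ hn)
        have h3 : K < 2 ^ K := Nat.lt_two_pow_self
        rw [Finset.mem_Ico]
        omega
    _ = 1 / 2 * ∑ k ∈ Finset.range K, (2 : ℝ) ^ (k + 1) * gammaSeq p τ Δ (k + 1) ^ (1 / 2 : ℝ) := by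
        rw [sum_Ico_blockLevel (fun k => gammaSeq p τ Δ k ^ (1 / 2 : ℝ)), Finset.mul_sum]
        refine Finset.sum_congr rfl fun k _ => ?_
        rw [pow_succ]
        ring
    _ ≤ 1 / 2 * 1 := by
        gcongr
        refine le_trans (hs.sum_le_tsum _ fun k _ => ?_) h
        have := h0 (k + 1)
        positivity
    _ = 1 / 2 := by norm_num

namespace IsSpecialCPlus

variable {p : ℝ≥0∞} [Fact (1 ≤ p)] {P : CTypeParams} {Δ τ δ η : ℕ → ℕ}
  {T : SeqSpace p →L[ℂ] SeqSpace p}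

/-- Orbit coordinates and entries of `x` agree on the flat end of the block. Conversely, a mass
above `‖x‖` forces `t > η`. -/
theorem blockMass_le_norm (hP : IsSpecialCPlus P Δ τ δ η) (hp : p ≠ ∞) {n t : ℕ} (hn : 1 ≤ n)
    (ht : t ≤ η (blockLevel n)) (x : SeqSpace p) : P.blockMass n t x ≤ ‖x‖ := by
  have hq := one_le_toReal hp
  rw [← Real.rpow_le_rpow_iff (P.blockMass_nonneg n t x) (norm_nonneg _)
    (show 0 < p.toReal by linarith), P.blockMass_rpow hp]
  have h1 : ∀ i ∈ Finset.Ico (P.blockLen n - t) (P.blockLen n),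
      ‖P.orbitCoord n x i‖ ^ p.toReal = ‖x (P.b n + i)‖ ^ p.toReal := by
    intro i hi
    rw [Finset.mem_Ico] at hi
    rw [CTypeParams.orbitCoord, hP.blockCoeff_eq_one hn hi.2 (Or.inr (by omega)), div_one]
  rw [Finset.sum_congr rfl h1]
  have h2 := lp.sum_rpow_le_norm_rpow (show 0 < p.toReal by linarith) x
    ((Finset.Ico (P.blockLen n - t) (P.blockLen n)).image (P.b n + ·))
  rwa [Finset.sum_image fun a _ c _ h => Nat.add_left_cancel h] at h2

theorem blockProj_pow_blockPart_eq_zero (hP : IsSpecialCPlus P Δ τ δ η) (hp : p ≠ ∞)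
    (hT : P.IsOperator T) {l : ℕ} (hl : 1 ≤ l) {n : ℕ} (hln : l ≠ n)
    (hlev : blockLevel n ≤ blockLevel l) (j : ℕ) (x : SeqSpace p) :
    P.blockProj hp l ((T ^ j) (P.blockPart n x)) = 0 := by
  rw [hT.blockProj_pow_blockPart]
  refine Finset.sum_eq_zero fun i _ => ?_
  rw [hP.blockProj_pow_eq_zero hp hT hl hln hlev, smul_zero]

/-- By time `j` only the last `j` coordinates have left block `n`, each with a factor at most `‖v
n‖`. Hölder over at most `Δ` terms turns their sum into a mass. -/
theorem norm_blockProj_pow_blockPart_le (hP : IsSpecialCPlus P Δ τ δ η) (hp : p ≠ ∞)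
    (hT : P.IsOperator T) {l : ℕ} (hl : 1 ≤ l) {n : ℕ} (hn : 1 ≤ n) (hln : l ≠ n) (j : ℕ)
    (x : SeqSpace p) :
    ‖P.blockProj hp l ((T ^ j) (P.blockPart n x))‖ ≤
      gammaSeq p τ Δ (blockLevel n) * P.blockMass n j x := by
  have hq := one_le_toReal hp
  have hq1 : 0 ≤ 1 - 1 / p.toReal := by
    rw [sub_nonneg, div_le_one (by linarith)]
    exact hq
  have hsub : Finset.Ico (P.blockLen n - j) (P.blockLen n) ⊆ Finset.range (P.blockLen n) := by
    intro i hi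
    rw [Finset.mem_Ico] at hi
    exact Finset.mem_range.2 hi.2
  rw [hT.blockProj_pow_blockPart, ← Finset.sum_subset hsub]
  · calc _ ≤ ∑ i ∈ Finset.Ico (P.blockLen n - j) (P.blockLen n),
          ‖P.v n‖ * ‖P.orbitCoord n x i‖ := by
          refine norm_sum_le_of_le _ fun i _ => ?_
          rw [norm_smul, mul_comm]
          gcongr
          exact (hP.norm_blockProj_pow_le hp hT hl n (i + j)).2 hn hln
      _ = ‖P.v n‖ * ∑ i ∈ Finset.Ico (P.blockLen n - j) (P.blockLen n),
          ‖P.orbitCoord n x i‖ := by rw [Finset.mul_sum]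
      _ ≤ ‖P.v n‖ * ((P.blockLen n : ℝ) ^ (1 - 1 / p.toReal) * P.blockMass n j x) := by
          gcongr
          refine (sum_le_card_rpow_mul _ _ (fun _ _ => norm_nonneg _) hq).trans ?_
          refine mul_le_mul_of_nonneg_right ?_ (P.blockMass_nonneg n j x)
          refine Real.rpow_le_rpow (by positivity) ?_ hq1
          rw [Nat.card_Ico]
          exact_mod_cast Nat.sub_le _ _
      _ = _ := by rw [hP.norm_v hn, hP.blockLen_eq hn, gammaSeq, mul_assoc]
  · intro i hi hi'
    rw [Finset.mem_range] at hi
    rw [Finset.mem_Ico] at hi'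
    rw [blockProj_pow_eq_zero_of_lt hp hT hln (by omega), smul_zero]

/-- The influence on the block number `l` of the blocks of higher level. -/
theorem norm_blockProj_sub_le (hP : IsSpecialCPlus P Δ τ δ η) (hp : p ≠ ∞)
    (hs : Summable fun k : ℕ => (2 : ℝ) ^ (k + 1) * gammaSeq p τ Δ (k + 1) ^ (1 / 2 : ℝ))
    (hs1 : ∑' k : ℕ, (2 : ℝ) ^ (k + 1) * gammaSeq p τ Δ (k + 1) ^ (1 / 2 : ℝ) ≤ 1)
    (hT : P.IsOperator T) {l : ℕ} (hl : 1 ≤ l) {j : ℕ} {x : SeqSpace p} {C : ℝ} (hC : 0 ≤ C)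
    (h : ∀ n, blockLevel l < blockLevel n →
      gammaSeq p τ Δ (blockLevel n) ^ (1 / 2 : ℝ) * P.blockMass n j x ≤ C) :
    ‖P.blockProj hp l ((T ^ j) x) - P.blockProj hp l ((T ^ j) (P.blockPart l x))‖ ≤ C / 2 := by
  have hlim : Tendsto (fun M => P.blockProj hp l ((T ^ j)
      (∑ n ∈ Finset.range M, P.blockPart n x)) - P.blockProj hp l ((T ^ j) (P.blockPart l x)))
      atTop (𝓝 (P.blockProj hp l ((T ^ j) x) - P.blockProj hp l ((T ^ j) (P.blockPart l x)))) := by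
    refine Tendsto.sub_const ?_ _
    exact (((P.blockProj hp l).continuous.comp (T ^ j).continuous).tendsto x).comp
      (P.tendsto_sum_blockPart hp x)
  refine le_of_tendsto hlim.norm ?_
  filter_upwards [eventually_gt_atTop l] with M hM
  rw [map_sum, map_sum, ← Finset.add_sum_erase _ _ (Finset.mem_range.2 hM), add_sub_cancel_left]
  set s := (Finset.range M).erase l
  have hg : ∀ k, 0 ≤ gammaSeq p τ Δ k ^ (1 / 2 : ℝ) := fun k =>
    Real.rpow_nonneg (gammaSeq_nonneg p τ Δ k) _
  have hterm : ∀ n ∈ s.erase 0, ‖P.blockProj hp l ((T ^ j) (P.blockPart n x))‖ ≤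
      gammaSeq p τ Δ (blockLevel n) ^ (1 / 2 : ℝ) * C := by
    intro n hn
    have hn0 : n ≠ 0 := Finset.ne_of_mem_erase hn
    have hnl : n ≠ l := Finset.ne_of_mem_erase (Finset.mem_of_mem_erase hn)
    rcases lt_or_ge (blockLevel l) (blockLevel n) with hlev | hlev
    · refine (hP.norm_blockProj_pow_blockPart_le hp hT hl (by omega) hnl.symm j x).trans ?_
      -- One factor `γ^(1/2)` is absorbed with the mass into `C`; the other is kept for the
      -- summation over blocks.
      have : gammaSeq p τ Δ (blockLevel n) = gammaSeq p τ Δ (blockLevel n) ^ (1 / 2 : ℝ) *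
          gammaSeq p τ Δ (blockLevel n) ^ (1 / 2 : ℝ) := by
        rw [← Real.sqrt_eq_rpow, Real.mul_self_sqrt (gammaSeq_nonneg _ _ _ _)]
      calc gammaSeq p τ Δ (blockLevel n) * P.blockMass n j x
          = gammaSeq p τ Δ (blockLevel n) ^ (1 / 2 : ℝ) *
            (gammaSeq p τ Δ (blockLevel n) ^ (1 / 2 : ℝ) * P.blockMass n j x) := by
            rw [← mul_assoc, ← this]
        _ ≤ _ := mul_le_mul_of_nonneg_left (h n hlev) (hg _)
    · rw [hP.blockProj_pow_blockPart_eq_zero hp hT hl hnl.symm hlev, norm_zero]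
      exact mul_nonneg (hg _) hC
  rw [← Finset.sum_erase (s := s) (a := 0)
    (f := fun n => P.blockProj hp l ((T ^ j) (P.blockPart n x)))
    (hP.blockProj_pow_blockPart_eq_zero hp hT hl (by omega) (blockLevel_mono (Nat.zero_le l)) j x)]
  refine (norm_sum_le_of_le _ hterm).trans ?_
  have hsum := mul_le_mul_of_nonneg_right
    (sum_sqrt_gammaSeq_le hs hs1 (Finset.notMem_erase 0 s)) hC
  rw [← Finset.sum_mul]
  linarith

/-- A hypercyclic vector has large mass in some block of arbitrarily high level. -/
theorem exists_lt_blockMass (hP : IsSpecialCPlus P Δ τ δ η) (hp : p ≠ ∞)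
    (hs : Summable fun k : ℕ => (2 : ℝ) ^ (k + 1) * gammaSeq p τ Δ (k + 1) ^ (1 / 2 : ℝ))
    (hs1 : ∑' k : ℕ, (2 : ℝ) ^ (k + 1) * gammaSeq p τ Δ (k + 1) ^ (1 / 2 : ℝ) ≤ 1)
    (hT : P.IsOperator T) {x : SeqSpace p} (hx : IsHypercyclicVector T x) {C : ℝ} (hC : 0 ≤ C)
    {l : ℕ} (hl : 1 ≤ l) :
    ∃ t n, blockLevel l < blockLevel n ∧
      C < gammaSeq p τ Δ (blockLevel n) ^ (1 / 2 : ℝ) * P.blockMass n t x := by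
  by_contra! hcon
  -- Otherwise the orbit stays bounded in block `l`: `R` bounds the block's own part at all times
  -- and `C / 2` the disturbance.
  set R : ℝ := ∑ i ∈ Finset.range (P.blockLen l), ‖P.orbitCoord l x i‖
  have hbd : ∀ j, ‖P.blockProj hp l ((T ^ j) x)‖ ≤ R + C / 2 := by
    intro j
    have h1 := hP.norm_blockProj_sub_le hp hs hs1 hT hl (j := j) (x := x) hC fun n hn => hcon j n hn
    have h2 : ‖P.blockProj hp l ((T ^ j) (P.blockPart l x))‖ ≤ R := by
      rw [hT.blockProj_pow_blockPart]
      refine norm_sum_le_of_le _ fun i _ => ?_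
      rw [norm_smul]
      exact mul_le_of_le_one_right (norm_nonneg _) (hP.norm_blockProj_pow_le hp hT hl l _).1
    have h3 := norm_sub_norm_le (P.blockProj hp l ((T ^ j) x))
      (P.blockProj hp l ((T ^ j) (P.blockPart l x)))
    linarith
  have hR : 0 ≤ R := Finset.sum_nonneg fun _ _ => norm_nonneg _
  -- An orbit point within `1` of `c e_{b_l}` would have norm above `R + C / 2` in block `l`.
  set c : ℝ := R + C / 2 + 2
  set y : SeqSpace p := (c : ℂ) • basisVec p (P.b l)
  obtain ⟨z, ⟨j, rfl⟩, hz⟩ := hx.exists_dist_lt y one_pos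
  have h1 : P.blockProj hp l y = y := by
    have := P.blockProj_basisVec_self hp l (P.blockLen_pos l)
    rw [add_zero] at this
    rw [map_smul, this]
  have h2 : ‖y‖ = c := by
    rw [norm_smul, norm_basisVec, mul_one, Complex.norm_real, Real.norm_of_nonneg (by positivity)]
  have h3 : ‖P.blockProj hp l (y - (T ^ j) x)‖ < 1 := by
    refine (P.norm_blockProj_le hp l _).trans_lt ?_
    rwa [dist_eq_norm] at hz
  rw [map_sub, h1] at h3
  have h4 := norm_sub_norm_le y (P.blockProj hp l ((T ^ j) x))
  have h5 := hbd j
  rw [h2] at h4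
  simp only [c] at h4
  linarith

/-! ### Times at which a heavy block has small norm -/

/-- The return of the orbit coordinates to the positions where the weights have product `1`. -/
theorem sum_orbitCoord_le (hP : IsSpecialCPlus P Δ τ δ η) (hp : p ≠ ∞) (hT : P.IsOperator T)
    {l : ℕ} (hl : 1 ≤ l) (j : ℕ) (x : SeqSpace p) {s : Finset ℕ}
    (hs : s ⊆ Finset.range (P.blockLen l))
    (hs1 : ∀ i ∈ s, P.blockCoeff l ((i + j) % P.blockLen l) = 1) :
    ∑ i ∈ s, ‖P.orbitCoord l x i‖ ^ p.toReal ≤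
      ‖P.blockProj hp l ((T ^ j) (P.blockPart l x))‖ ^ p.toReal := by
  have hq := one_le_toReal hp
  set L := P.blockLen l
  have hinj : ∀ a ∈ Finset.range L, ∀ c ∈ Finset.range L, (a + j) % L = (c + j) % L → a = c := by
    intro a ha c hc hac
    have h1 : a ≡ c [MOD L] := Nat.ModEq.add_right_cancel' j hac
    exact Nat.ModEq.eq_of_lt_of_lt h1 (Finset.mem_range.1 ha) (Finset.mem_range.1 hc)
  choose σ hσ hσ' using fun i => hP.blockProj_pow_self hp hT hl (i + j)
  have hcoord : ∀ i ∈ s, ‖P.orbitCoord l x i‖ =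
      ‖P.blockProj hp l ((T ^ j) (P.blockPart l x)) (P.b l + (i + j) % L)‖ := by
    intro i hi
    have hi' := hs hi
    have h1 : P.blockProj hp l ((T ^ j) (P.blockPart l x)) (P.b l + (i + j) % L) =
        P.orbitCoord l x i * σ i := by
      rw [hT.blockProj_pow_blockPart, lp.coeFn_sum, Finset.sum_apply, Finset.sum_eq_single i]
      · rw [hσ', hs1 i hi]
        simp [basisVec, L]
      · intro a ha hai
        rw [hσ']
        have : (i + j) % L ≠ (a + j) % L := fun h => hai (hinj a ha i hi' h.symm)
        simp [basisVec, L, this]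
      · exact fun h => absurd hi' h
    rw [h1, norm_mul, hσ, mul_one]
  have h2 := lp.sum_rpow_le_norm_rpow (show 0 < p.toReal by linarith)
    (P.blockProj hp l ((T ^ j) (P.blockPart l x))) (s.image fun i => P.b l + (i + j) % L)
  rw [Finset.sum_image fun a ha c hc h =>
    hinj a (hs ha) c (hs hc) (Nat.add_left_cancel h)] at h2
  refine le_trans (le_of_eq (Finset.sum_congr rfl fun i hi => ?_)) h2
  rw [hcoord i hi]

open Classical in
/-- Markov's inequality for the times at which a block has small norm. -/
theorem card_small_le (hP : IsSpecialCPlus P Δ τ δ η) (hp : p ≠ ∞) (hT : P.IsOperator T)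
    {l : ℕ} (hl : 1 ≤ l) (x : SeqSpace p) (t : ℕ) (s : Finset ℕ) (M : ℕ)
    (hpos : 0 < P.blockMass l t x)
    (hM : ∀ i ∈ Finset.Ico (P.blockLen l - t) (P.blockLen l),
      (s.filter fun j => P.blockCoeff l ((i + j) % P.blockLen l) ≠ 1).card ≤ M)
    (hsmall : ∀ j ∈ s, ‖P.blockProj hp l ((T ^ j) (P.blockPart l x))‖ < P.blockMass l t x / 2) :
    s.card ≤ 2 * M := by
  have hq := one_le_toReal hp
  set q := p.toReal
  set L := P.blockLen l
  set S := Finset.Ico (L - t) L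
  set Y := P.blockMass l t x
  have hY : 0 < Y ^ q := Real.rpow_pos_of_pos hpos _
  have hYS : Y ^ q = ∑ i ∈ S, ‖P.orbitCoord l x i‖ ^ q := P.blockMass_rpow hp l t x
  -- At such a time the coordinates sitting where the product is `1` carry at most `(Y / 2) ^ q ≤ Y
  -- ^ q / 2`, so the badly placed ones carry at least half of `Y ^ q`.
  have h1 : ∀ j ∈ s, Y ^ q / 2 ≤ ∑ i ∈ S, if P.blockCoeff l ((i + j) % L) ≠ 1 then
      ‖P.orbitCoord l x i‖ ^ q else 0 := by
    intro j hj
    rw [← Finset.sum_filter]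
    have h2 := hP.sum_orbitCoord_le hp hT hl j x
      (s := S.filter fun i => ¬ P.blockCoeff l ((i + j) % L) ≠ 1)
      (fun i hi => Finset.mem_range.2 (Finset.mem_Ico.1 (Finset.mem_filter.1 hi).1).2)
      (fun i hi => not_not.1 (Finset.mem_filter.1 hi).2)
    have h3 := Finset.sum_filter_add_sum_filter_not S
      (fun i => P.blockCoeff l ((i + j) % L) ≠ 1) fun i => ‖P.orbitCoord l x i‖ ^ q
    have h4 : ‖P.blockProj hp l ((T ^ j) (P.blockPart l x))‖ ^ q ≤ (Y / 2) ^ q :=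
      Real.rpow_le_rpow (norm_nonneg _) (hsmall j hj).le (by linarith)
    have h5 : (Y / 2) ^ q ≤ Y ^ q / 2 := by
      rw [Real.div_rpow hpos.le (by norm_num)]
      have : (2 : ℝ) ≤ 2 ^ q := by
        simpa using Real.rpow_le_rpow_of_exponent_le (by norm_num : (1 : ℝ) ≤ 2) hq
      gcongr
    linarith
  have h6 : (s.card : ℝ) * (Y ^ q / 2) ≤ Y ^ q * M := by
    calc (s.card : ℝ) * (Y ^ q / 2) = ∑ j ∈ s, Y ^ q / 2 := by
          rw [Finset.sum_const, nsmul_eq_mul]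
      _ ≤ _ := Finset.sum_le_sum h1
      _ = ∑ i ∈ S, ‖P.orbitCoord l x i‖ ^ q *
          (s.filter fun j => P.blockCoeff l ((i + j) % L) ≠ 1).card := by
          -- Counted the other way, each coordinate is badly placed at most `M` times.
          rw [Finset.sum_comm]
          refine Finset.sum_congr rfl fun i _ => ?_
          rw [← Finset.sum_filter, Finset.sum_const, nsmul_eq_mul, mul_comm]
      _ ≤ ∑ i ∈ S, ‖P.orbitCoord l x i‖ ^ q * M := by
          refine Finset.sum_le_sum fun i hi => ?_
          gcongr
          exact hM i hi
      _ = Y ^ q * M := by rw [← Finset.sum_mul, hYS]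
  have h7 : (s.card : ℝ) ≤ 2 * M := by
    by_contra! h
    nlinarith
  exact_mod_cast h7

end IsSpecialCPlus

theorem card_filter_Ico_le_of_periodic {B : ℕ → Prop} [DecidablePred B] {a : ℕ} (ha : 0 < a)
    (hB : Function.Periodic B a) (t u : ℕ) :
    ((Finset.Ico t u).filter B).card ≤ ((u - t) / a + 1) * ((Finset.range a).filter B).card := by
  have key : ∀ m, ((Finset.Ico t (t + m * a)).filter B).card ≤
      m * ((Finset.range a).filter B).card := by
    intro m
    induction m with
    | zero => simp
    | succ m ih =>
      have h1 : Finset.Ico t (t + (m + 1) * a) =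
          Finset.Ico t (t + m * a) ∪ Finset.Ico (t + m * a) (t + m * a + a) := by
        rw [Finset.Ico_union_Ico_eq_Ico (by omega) (by omega)]
        congr 1
        ring
      rw [h1, Finset.filter_union]
      refine (Finset.card_union_le _ _).trans ?_
      rw [Nat.filter_Ico_card_eq_of_periodic _ _ _ hB, Nat.count_eq_card_filter_range,
        Nat.succ_mul]
      exact Nat.add_le_add_right ih _
  refine le_trans (Finset.card_le_card (Finset.filter_subset_filter _ ?_)) (key ((u - t) / a + 1))
  refine Finset.Ico_subset_Ico_right ?_
  have := Nat.lt_div_mul_add ha (a := u - t)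
  rw [Nat.succ_mul]
  omega

namespace IsSpecialCPlus

variable {p : ℝ≥0∞} [Fact (1 ≤ p)] {P : CTypeParams} {Δ τ δ η : ℕ → ℕ}
  {T : SeqSpace p →L[ℂ] SeqSpace p}

-- A coordinate among the last `t` has passed the end of the block exactly once at each time `j ∈
-- [t, u)`, and has not yet reached the trapezoidal dip. Only the initial dip of width `2δ` can
-- hurt.
open Classical in
theorem card_coeff_ne_one_le_of_lt (hP : IsSpecialCPlus P Δ τ δ η) {l : ℕ} (hl : 1 ≤ l)
    {t u i : ℕ} (hu : u + 2 * δ (blockLevel l) + 2 * η (blockLevel l) ≤ P.blockLen l)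
    (hi : i ∈ Finset.Ico (P.blockLen l - t) (P.blockLen l)) :
    ((Finset.Ico t u).filter fun j => P.blockCoeff l ((i + j) % P.blockLen l) ≠ 1).card ≤
      2 * δ (blockLevel l) := by
  rw [Finset.mem_Ico] at hi
  have hsub : ((Finset.Ico t u).filter fun j => P.blockCoeff l ((i + j) % P.blockLen l) ≠ 1) ⊆
      Finset.Ico (P.blockLen l - i) (P.blockLen l - i + 2 * δ (blockLevel l)) := by
    intro j hj
    rw [Finset.mem_filter, Finset.mem_Ico] at hj
    obtain ⟨⟨hj1, hj2⟩, hj3⟩ := hj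
    have hr : (i + j) % P.blockLen l = i + j - P.blockLen l := by
      rw [Nat.mod_eq_sub_mod (by omega), Nat.mod_eq_of_lt (by omega)]
    rw [hr] at hj3
    rw [Finset.mem_Ico]
    refine ⟨by omega, ?_⟩
    by_contra! h
    exact hj3 (hP.blockCoeff_eq_one hl (by omega) (Or.inl ⟨by omega, by omega⟩))
  refine (Finset.card_le_card hsub).trans ?_
  rw [Nat.card_Ico]
  omega

-- One full turn meets the two dips, of widths `2δ` and `2δ + η`; the `+ 1` pays for an incomplete
-- turn.
open Classical in
theorem card_coeff_ne_one_le (hP : IsSpecialCPlus P Δ τ δ η) {l : ℕ} (hl : 1 ≤ l) (t u i : ℕ) :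
    ((Finset.Ico t u).filter fun j => P.blockCoeff l ((i + j) % P.blockLen l) ≠ 1).card ≤
      ((u - t) / P.blockLen l + 1) * (4 * δ (blockLevel l) + η (blockLevel l)) := by
  set B : ℕ → Prop := fun r => P.blockCoeff l (r % P.blockLen l) ≠ 1
  have hB : Function.Periodic B (P.blockLen l) := fun r => by
    simp only [B, Nat.add_mod_right]
  have h1 : ((Finset.Ico t u).filter fun j => B (i + j)).card ≤
      ((Finset.Ico (i + t) (i + u)).filter B).card := by
    refine Finset.card_le_card_of_injOn (i + ·) (fun j hj => ?_)
      fun a _ c _ h => Nat.add_left_cancel h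
    simp only [Finset.coe_filter, Finset.mem_Ico, Set.mem_ofPred_eq] at hj ⊢
    exact ⟨by omega, hj.2⟩
  have h2 := card_filter_Ico_le_of_periodic (P.blockLen_pos l) hB (i + t) (i + u)
  have h3 : ((Finset.range (P.blockLen l)).filter B).card ≤
      4 * δ (blockLevel l) + η (blockLevel l) := by
    have hsub : (Finset.range (P.blockLen l)).filter B ⊆ Finset.range (2 * δ (blockLevel l)) ∪
        Finset.Ico (P.blockLen l - 2 * δ (blockLevel l) - 2 * η (blockLevel l))
          (P.blockLen l - η (blockLevel l)) := by
      intro r hr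
      rw [Finset.mem_filter, Finset.mem_range] at hr
      obtain ⟨hr1, hr2⟩ := hr
      simp only [B, Nat.mod_eq_of_lt hr1] at hr2
      rw [Finset.mem_union, Finset.mem_range, Finset.mem_Ico]
      by_contra! h
      exact hr2 (hP.blockCoeff_eq_one hl hr1 (by omega))
    refine (Finset.card_le_card hsub).trans ((Finset.card_union_le _ _).trans ?_)
    rw [Finset.card_range, Nat.card_Ico]
    omega
  refine h1.trans (h2.trans ?_)
  rw [Nat.add_sub_add_left]
  exact Nat.mul_le_mul_left _ h3

/-- Between its arrival time `t` and a time `u` up to which it is not perturbed, a block of large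
mass keeps the norm of the orbit large most of the time. -/
theorem card_norm_lt_le (hP : IsSpecialCPlus P Δ τ δ η) (hp : p ≠ ∞)
    (hs : Summable fun k : ℕ => (2 : ℝ) ^ (k + 1) * gammaSeq p τ Δ (k + 1) ^ (1 / 2 : ℝ))
    (hs1 : ∑' k : ℕ, (2 : ℝ) ^ (k + 1) * gammaSeq p τ Δ (k + 1) ^ (1 / 2 : ℝ) ≤ 1)
    (hΔ : ∀ k, 1 ≤ k → 4 * δ k + 3 * η k ≤ Δ k)
    (hT : P.IsOperator T) {x : SeqSpace p} {l t u : ℕ} (hl : 1 ≤ l) (htu : t ≤ u)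
    (hη : η (blockLevel l) ≤ t) (hpos : 0 < P.blockMass l t x)
    (h : ∀ j < u, ∀ n, blockLevel l < blockLevel n →
      gammaSeq p τ Δ (blockLevel n) ^ (1 / 2 : ℝ) * P.blockMass n j x ≤ P.blockMass l t x / 2)
    {ε θ : ℝ} (hε : ε ≤ P.blockMass l t x / 4) (hθ : 0 < θ)
    (hθ1 : (δ (blockLevel l) : ℝ) ≤ θ * η (blockLevel l))
    (hθ2 : (η (blockLevel l) : ℝ) ≤ θ * Δ (blockLevel l)) :
    (({j | ‖(T ^ j) x‖ < ε} ∩ Set.Ico t u).ncard : ℝ) ≤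
        θ * (14 * Δ (blockLevel l) + 10 * ((u : ℝ) - t)) ∧
      (({j | ‖(T ^ j) x‖ < ε} ∩ Set.Ico t u).ncard : ℝ) ≤ 54 * θ * u := by
  classical
  set k := blockLevel l
  set s := (Finset.Ico t u).filter fun j => ‖(T ^ j) x‖ < ε with hsdef
  have hcard : ({j | ‖(T ^ j) x‖ < ε} ∩ Set.Ico t u).ncard = s.card := by
    rw [← Set.ncard_coe_finset]
    congr 1
    ext j
    simp [hsdef, and_comm]
  rw [hcard]
  -- The disturbance is at most half of `Y / 2`, with `Y` the mass, and `ε ≤ Y / 4`: together less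
  -- than `Y / 2`.
  have hsmall : ∀ j ∈ s,
      ‖P.blockProj hp l ((T ^ j) (P.blockPart l x))‖ < P.blockMass l t x / 2 := by
    intro j hj
    rw [hsdef, Finset.mem_filter, Finset.mem_Ico] at hj
    have h1 := hP.norm_blockProj_sub_le hp hs hs1 hT hl (j := j) (x := x)
      (half_pos hpos).le (h j hj.1.2)
    have h2 := P.norm_blockProj_le hp l ((T ^ j) x)
    have h3 := norm_sub_norm_le (P.blockProj hp l ((T ^ j) (P.blockPart l x)))
      (P.blockProj hp l ((T ^ j) x))
    rw [norm_sub_rev] at h3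
    linarith [hj.2]
  have hsub : ∀ i, (s.filter fun j => P.blockCoeff l ((i + j) % P.blockLen l) ≠ 1).card ≤
      ((Finset.Ico t u).filter fun j => P.blockCoeff l ((i + j) % P.blockLen l) ≠ 1).card :=
    fun i => Finset.card_le_card (Finset.filter_subset_filter _ (Finset.filter_subset _ _))
  have hlen : P.blockLen l = Δ k := hP.blockLen_eq hl
  have hk : 1 ≤ k := one_le_blockLevel l
  have hΔk : 4 * (δ k : ℝ) + 3 * η k ≤ Δ k := by exact_mod_cast hΔ k hk
  have hΔ0 : (0 : ℝ) < Δ k := by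
    have := P.blockLen_pos l
    rw [hlen] at this
    exact_mod_cast this
  have hηt : (η k : ℝ) ≤ t := by exact_mod_cast hη
  have htu' : (t : ℝ) ≤ u := by exact_mod_cast htu
  have hη0 : (0 : ℝ) ≤ η k := by positivity
  have hδ0 : (0 : ℝ) ≤ δ k := by positivity
  have hηθ : θ * η k ≤ θ * Δ k := mul_le_mul_of_nonneg_left (by linarith) hθ.le
  have hηu : θ * η k ≤ θ * u := mul_le_mul_of_nonneg_left (by linarith) hθ.le
  have hut : 0 ≤ θ * ((u : ℝ) - t) := mul_nonneg hθ.le (by linarith)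
  have hut2 : θ * ((u : ℝ) - t) ≤ θ * u := by
    gcongr
    have : (0 : ℝ) ≤ t := by positivity
    linarith
  -- Before the trapezoidal dip there are at most `4δ ≤ 4θη` bad times, and `η ≤ t ≤ u`. Afterwards
  -- `u` is comparable to `Δ` and the proportion `(4δ + η) / Δ ≤ 5θ` is what counts.
  rcases le_or_gt (u + 2 * δ k + 2 * η k) (P.blockLen l) with hu | hu
  · have h1 := hP.card_small_le hp hT hl x t s (2 * δ k) hpos
      (fun i hi => (hsub i).trans (hP.card_coeff_ne_one_le_of_lt hl hu hi)) hsmall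
    have h2 : (s.card : ℝ) ≤ 4 * δ k := by
      have : (s.card : ℝ) ≤ ((2 * (2 * δ k) : ℕ) : ℝ) := by exact_mod_cast h1
      push_cast at this
      linarith
    constructor <;> nlinarith
  · have h1 := hP.card_small_le hp hT hl x t s _ hpos
      (fun i hi => (hsub i).trans (hP.card_coeff_ne_one_le hl t u i)) hsmall
    rw [hlen] at h1 hu
    have hu' : (Δ k : ℝ) < u + 2 * δ k + 2 * η k := by exact_mod_cast hu
    have hdiv : (((u - t) / Δ k : ℕ) : ℝ) ≤ ((u : ℝ) - t) / Δ k := by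
      rw [← Nat.cast_sub htu]
      exact Nat.cast_div_le
    have hβ : (4 * δ k + η k : ℝ) ≤ 5 * (θ * Δ k) := by nlinarith
    have h2 : (s.card : ℝ) ≤ 2 * ((((u : ℝ) - t) / Δ k + 1) * (5 * (θ * Δ k))) := by
      have h3 : (s.card : ℝ) ≤ ((2 * (((u - t) / Δ k + 1) * (4 * δ k + η k)) : ℕ) : ℝ) := by
        exact_mod_cast h1
      push_cast at h3
      refine h3.trans ?_
      have : 0 ≤ ((u : ℝ) - t) / Δ k := div_nonneg (by linarith) hΔ0.le
      gcongr
    have h4 : 2 * ((((u : ℝ) - t) / Δ k + 1) * (5 * (θ * Δ k))) =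
        10 * (θ * ((u : ℝ) - t)) + 10 * (θ * Δ k) := by
      field_simp
      ring
    rw [h4] at h2
    -- From `Δ < u + 2δ + 2η`, `4δ + 3η ≤ Δ` and `η ≤ t ≤ u`.
    have hΔu : θ * Δ k ≤ θ * (4 * u) := by
      gcongr
      linarith
    constructor
    · nlinarith
    · nlinarith

end IsSpecialCPlus

/-! ### Gluing the phases -/

/-- A set of integers which is sparse on successive intervals has density zero. -/
theorem tendsto_ncard_div_zero {A : Set ℕ} {t a d : ℕ → ℕ} (ht : Monotone t)
    (hat : ∀ i, a i ≤ t i) (ha : Tendsto a atTop atTop) (had : ∀ i, 2 * a i ≤ d i)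
    (hda : ∀ i, d i ≤ a (i + 1))
    (hA : ∀ θ : ℝ, 0 < θ → ∃ i₀, ∀ i, i₀ ≤ i → ∀ u, t i ≤ u → u ≤ t (i + 1) →
      ((A ∩ Set.Ico (t i) u).ncard : ℝ) ≤ θ * (14 * d i + 10 * ((u : ℝ) - t i)) ∧
      ((A ∩ Set.Ico (t i) u).ncard : ℝ) ≤ 54 * θ * u) :
    Tendsto (fun N : ℕ => ((A ∩ Set.Iic N).ncard : ℝ) / ((N : ℝ) + 1)) atTop (𝓝 0) := by
  have hsplit : ∀ r s u, r ≤ s → s ≤ u → ((A ∩ Set.Ico r u).ncard : ℝ) ≤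
      (A ∩ Set.Ico r s).ncard + (A ∩ Set.Ico s u).ncard := by
    intro r s u h1 h2
    rw [← Set.Ico_union_Ico_eq_Ico h1 h2, Set.inter_union_distrib_left]
    exact_mod_cast Set.ncard_union_le _ _
  have ht' : Tendsto t atTop atTop := tendsto_atTop_mono hat ha
  rw [Metric.tendsto_atTop]
  intro ε hε
  -- Finished phases will cost `(28 + 10)θ` and the current one `54θ`, so `92θ = ε / 2`; the other
  -- half of `ε` pays for `[0, t i₀)`.
  obtain ⟨i₀, hi₀⟩ := hA (ε / 184) (by positivity)
  set θ := ε / 184 with hθ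
  have hθ0 : 0 < θ := by positivity
  -- The terms in `t` telescope, and `28 a_i + 14 d_i ≤ 28 d_i ≤ 28 a_{i+1}` closes the induction.
  have key : ∀ i, i₀ ≤ i →
      ((A ∩ Set.Ico (t i₀) (t i)).ncard : ℝ) ≤ θ * (28 * a i + 10 * t i) := by
    intro i hi
    induction i, hi using Nat.le_induction with
    | base =>
      rw [Set.Ico_self, Set.inter_empty, Set.ncard_empty]
      push_cast
      positivity
    | succ i hi ih =>
      have h1 := hsplit (t i₀) (t i) (t (i + 1)) (ht hi) (ht i.le_succ)
      have h2 := (hi₀ i hi (t (i + 1)) (ht i.le_succ) le_rfl).1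
      have h3 : (2 * a i : ℝ) ≤ d i := by exact_mod_cast had i
      have h4 : (d i : ℝ) ≤ a (i + 1) := by exact_mod_cast hda i
      nlinarith
  obtain ⟨N₀, hN₀⟩ := exists_nat_gt (t i₀ / (ε / 2))
  refine ⟨max N₀ (t i₀), fun N hN => ?_⟩
  have hN1 : N₀ ≤ N := (le_max_left _ _).trans hN
  have hN2 : t i₀ ≤ N := (le_max_right _ _).trans hN
  obtain ⟨i, hi, hiN, hNi⟩ : ∃ i, i₀ ≤ i ∧ t i ≤ N ∧ N + 1 ≤ t (i + 1) := by
    by_contra! hcon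
    have : ∀ i, i₀ ≤ i → t i ≤ N := by
      intro i hi
      induction i, hi using Nat.le_induction with
      | base => exact hN2
      | succ i hi ih => exact Nat.lt_succ_iff.1 (hcon i hi ih)
    obtain ⟨i, hi1, hi2⟩ := ((eventually_ge_atTop i₀).and (ht'.eventually_gt_atTop N)).exists
    exact absurd (this i hi1) (by omega)
  have hIic : Set.Iic N = Set.Ico 0 (N + 1) := by
    ext j
    simp
  have h1 := hsplit 0 (t i₀) (N + 1) (Nat.zero_le _) (by omega)
  have h2 := hsplit (t i₀) (t i) (N + 1) (ht hi) (by omega)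
  have h3 := key i hi
  -- In the current phase `N` may be far smaller than `d i`, so the bound proportional to `u` is
  -- needed.
  have h4 := (hi₀ i hi (N + 1) (by omega) hNi).2
  have h5 : ((A ∩ Set.Ico 0 (t i₀)).ncard : ℝ) ≤ t i₀ := by
    have := Set.ncard_le_ncard (Set.inter_subset_right (s := A)) (Set.finite_Ico 0 (t i₀))
    have h' : (Set.Ico 0 (t i₀)).ncard = t i₀ := by
      rw [Set.ncard_eq_toFinset_card']
      simp
    rw [h'] at this
    exact_mod_cast this
  have h6 : (a i : ℝ) ≤ t i := by exact_mod_cast hat i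
  have h7 : (t i : ℝ) ≤ N := by exact_mod_cast hiN
  have h8 : (t i₀ : ℝ) < ε / 2 * (N + 1) := by
    have h9 : (N₀ : ℝ) ≤ N := by exact_mod_cast hN1
    rw [div_lt_iff₀ (by positivity)] at hN₀
    nlinarith
  rw [Real.dist_eq, sub_zero, abs_of_nonneg (by positivity), div_lt_iff₀ (by positivity), hIic]
  push_cast at h4
  have h10 : θ * (28 * a i + 10 * t i) ≤ 38 * θ * (N + 1) := by nlinarith
  have h11 : 92 * θ = ε / 2 := by rw [hθ]; ring
  nlinarith

/-! ### The sequence of leading blocks -/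

theorem sqrt_gammaSeq_le {p : ℝ≥0∞} {τ Δ : ℕ → ℕ}
    (hs : Summable fun k : ℕ => (2 : ℝ) ^ (k + 1) * gammaSeq p τ Δ (k + 1) ^ (1 / 2 : ℝ))
    (h : ∑' k : ℕ, (2 : ℝ) ^ (k + 1) * gammaSeq p τ Δ (k + 1) ^ (1 / 2 : ℝ) ≤ 1)
    {n : ℕ} (hn : 1 ≤ n) : gammaSeq p τ Δ (blockLevel n) ^ (1 / 2 : ℝ) ≤ 1 / 2 := by
  have := sum_sqrt_gammaSeq_le hs h (s := {n}) (by simp; omega)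
  simpa using this

theorem one_le_of_blockLevel_lt {l n : ℕ} (h : blockLevel l < blockLevel n) : 1 ≤ n := by
  by_contra! h0
  have := blockLevel_mono (show n ≤ l by omega)
  omega

namespace IsSpecialCPlus

variable {p : ℝ≥0∞} [Fact (1 ≤ p)] {P : CTypeParams} {Δ τ δ η : ℕ → ℕ}
  {T : SeqSpace p →L[ℂ] SeqSpace p}

/-- The first time at which some block of level higher than that of `l` carries, among its last
coordinates, a mass large compared with `C`. -/
theorem exists_first_blockMass (hP : IsSpecialCPlus P Δ τ δ η) (hp : p ≠ ∞)
    (hs : Summable fun k : ℕ => (2 : ℝ) ^ (k + 1) * gammaSeq p τ Δ (k + 1) ^ (1 / 2 : ℝ))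
    (hs1 : ∑' k : ℕ, (2 : ℝ) ^ (k + 1) * gammaSeq p τ Δ (k + 1) ^ (1 / 2 : ℝ) ≤ 1)
    (hT : P.IsOperator T) {x : SeqSpace p} (hx : IsHypercyclicVector T x) {C : ℝ} (hC : 0 ≤ C)
    {l : ℕ} (hl : 1 ≤ l) :
    ∃ t l', blockLevel l < blockLevel l' ∧
      C < gammaSeq p τ Δ (blockLevel l') ^ (1 / 2 : ℝ) * P.blockMass l' t x ∧
      C < P.blockMass l' t x / 2 ∧
      ∀ s < t, ∀ n, blockLevel l < blockLevel n →
        gammaSeq p τ Δ (blockLevel n) ^ (1 / 2 : ℝ) * P.blockMass n s x ≤ C := by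
  classical
  have hex := hP.exists_lt_blockMass hp hs hs1 hT hx hC hl
  obtain ⟨l', h1, h2⟩ := Nat.find_spec hex
  refine ⟨Nat.find hex, l', h1, h2, h2.trans_le ?_, fun s hs' n hn => ?_⟩
  -- As `γ^(1/2) ≤ 1/2`, the mass itself exceeds `2C`.
  · have h3 := mul_le_mul_of_nonneg_right (sqrt_gammaSeq_le hs hs1 (one_le_of_blockLevel_lt h1))
      (P.blockMass_nonneg l' (Nat.find hex) x)
    linarith
  · by_contra! h
    exact Nat.find_min hex hs' ⟨n, hn, h⟩

/-- The block number `s.1` carries, among its last `s.2` coordinates, a mass larger than the norm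
of `x`, and is not perturbed before the time `s.2`. -/
structure IsLeading (P : CTypeParams) (τ Δ : ℕ → ℕ) (x : SeqSpace p) (s : ℕ × ℕ) : Prop where
  one_le : 1 ≤ s.1
  norm_lt : ‖x‖ < P.blockMass s.1 s.2 x
  unperturbed : ∀ j < s.2, ∀ n, blockLevel s.1 < blockLevel n →
    gammaSeq p τ Δ (blockLevel n) ^ (1 / 2 : ℝ) * P.blockMass n j x ≤ P.blockMass s.1 s.2 x / 2

theorem exists_isLeading (hP : IsSpecialCPlus P Δ τ δ η) (hp : p ≠ ∞)
    (hs : Summable fun k : ℕ => (2 : ℝ) ^ (k + 1) * gammaSeq p τ Δ (k + 1) ^ (1 / 2 : ℝ))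
    (hs1 : ∑' k : ℕ, (2 : ℝ) ^ (k + 1) * gammaSeq p τ Δ (k + 1) ^ (1 / 2 : ℝ) ≤ 1)
    (hT : P.IsOperator T) {x : SeqSpace p} (hx : IsHypercyclicVector T x) :
    ∃ s, IsLeading P τ Δ x s := by
  obtain ⟨t, l, h1, -, h2, h3⟩ := hP.exists_first_blockMass hp hs hs1 hT hx (norm_nonneg x) le_rfl
  have := norm_nonneg x
  refine ⟨(l, t), one_le_of_blockLevel_lt h1, by dsimp only; linarith, fun j hj n hn => ?_⟩
  have := h3 j hj n (h1.trans hn)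
  dsimp only
  linarith

/-- Take `C` to be half of the current mass in `exists_first_blockMass`: the new mass then exceeds
the current one, and minimality of the new time bounds the disturbance of block `s.1` until then.
The new time is not earlier than `s.2`, since block `s.1` is unperturbed before `s.2`. -/
theorem IsLeading.exists_next (hP : IsSpecialCPlus P Δ τ δ η) (hp : p ≠ ∞)
    (hs : Summable fun k : ℕ => (2 : ℝ) ^ (k + 1) * gammaSeq p τ Δ (k + 1) ^ (1 / 2 : ℝ))
    (hs1 : ∑' k : ℕ, (2 : ℝ) ^ (k + 1) * gammaSeq p τ Δ (k + 1) ^ (1 / 2 : ℝ) ≤ 1)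
    (hT : P.IsOperator T) {x : SeqSpace p} (hx : IsHypercyclicVector T x) {s : ℕ × ℕ}
    (h : IsLeading P τ Δ x s) :
    ∃ s', IsLeading P τ Δ x s' ∧ s.2 ≤ s'.2 ∧ blockLevel s.1 < blockLevel s'.1 ∧
      P.blockMass s.1 s.2 x ≤ P.blockMass s'.1 s'.2 x ∧
      ∀ j < s'.2, ∀ n, blockLevel s.1 < blockLevel n →
        gammaSeq p τ Δ (blockLevel n) ^ (1 / 2 : ℝ) * P.blockMass n j x ≤
          P.blockMass s.1 s.2 x / 2 := by
  obtain ⟨t, l', h1, h2, h3, h5⟩ := hP.exists_first_blockMass hp hs hs1 hT hx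
    (half_pos (h.norm_lt.trans_le' (norm_nonneg x))).le h.one_le
  have h4 : P.blockMass s.1 s.2 x ≤ P.blockMass l' t x := by linarith
  refine ⟨(l', t), ⟨one_le_of_blockLevel_lt h1, h.norm_lt.trans_le h4,
    fun j hj n hn => (h5 j hj n (h1.trans hn)).trans ?_⟩, ?_, h1, h4, h5⟩
  · dsimp only
    linarith
  · by_contra! hlt
    exact absurd (h.unperturbed _ hlt l' h1) (not_le.2 h2)

theorem tendsto_ncard_norm_lt (hP : IsSpecialCPlus P Δ τ δ η) (hp : p ≠ ∞)
    (hs : Summable fun k : ℕ => (2 : ℝ) ^ (k + 1) * gammaSeq p τ Δ (k + 1) ^ (1 / 2 : ℝ))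
    (hs1 : ∑' k : ℕ, (2 : ℝ) ^ (k + 1) * gammaSeq p τ Δ (k + 1) ^ (1 / 2 : ℝ) ≤ 1)
    (hΔ : ∀ k, 1 ≤ k → 4 * δ k + 3 * η k ≤ Δ k)
    (hΔ' : ∀ k, 1 ≤ k → Δ k ≤ η (k + 1))
    (hηΔ : Tendsto (fun k => (η k : ℝ) / (Δ k : ℝ)) atTop (𝓝 0))
    (hδη : Tendsto (fun k => (δ k : ℝ) / (η k : ℝ)) atTop (𝓝 0))
    (hT : P.IsOperator T) {x : SeqSpace p} (hx : IsHypercyclicVector T x) :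
    ∃ ε : ℝ, 0 < ε ∧ Tendsto (fun N : ℕ =>
      (({j | ‖(T ^ j) x‖ < ε} ∩ Set.Iic N).ncard : ℝ) / ((N : ℝ) + 1)) atTop (𝓝 0) := by
  obtain ⟨s₀, hs₀⟩ := hP.exists_isLeading hp hs hs1 hT hx
  choose! next hnext using fun s (h : IsLeading P τ Δ x s) => h.exists_next hP hp hs hs1 hT hx
  set f : ℕ → ℕ × ℕ := fun i => next^[i] s₀
  have hf_succ : ∀ i, f (i + 1) = next (f i) := fun i => Function.iterate_succ_apply' _ _ _
  have hlead : ∀ i, IsLeading P τ Δ x (f i) := by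
    intro i
    induction i with
    | zero => exact hs₀
    | succ i ih => rw [hf_succ]; exact (hnext _ ih).1
  have hstep := fun i => (hnext _ (hlead i)).2
  simp only [← hf_succ] at hstep
  set κ : ℕ → ℕ := fun i => blockLevel (f i).1
  have hκ1 : ∀ i, 1 ≤ κ i := fun i => one_le_blockLevel _
  have hκ : StrictMono κ := strictMono_nat_of_lt_succ fun i => (hstep i).2.1
  have ht : Monotone fun i => (f i).2 := monotone_nat_of_le_succ fun i => (hstep i).1
  have hY : Monotone fun i => P.blockMass (f i).1 (f i).2 x :=
    monotone_nat_of_le_succ fun i => (hstep i).2.2.1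
  have hpos : ∀ i, 0 < P.blockMass (f i).1 (f i).2 x := fun i =>
    (norm_nonneg x).trans_lt (hlead i).norm_lt
  have hηt : ∀ i, η (κ i) ≤ (f i).2 := by
    intro i
    by_contra! hlt
    exact absurd (hP.blockMass_le_norm hp (hlead i).one_le hlt.le x) (not_le.2 (hlead i).norm_lt)
  have hηκ : StrictMono fun i => η (κ i) := fun i j hij =>
    hP.η_strictMonoOn (hκ1 i) (hκ1 j) (hκ hij)
  -- A quarter of the first mass serves all phases, because the masses do not decrease.
  refine ⟨P.blockMass (f 0).1 (f 0).2 x / 4, by have := hpos 0; positivity, ?_⟩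
  refine tendsto_ncard_div_zero (t := fun i => (f i).2) (a := fun i => η (κ i))
    (d := fun i => Δ (κ i)) ht hηt hηκ.tendsto_atTop (fun i => ?_) (fun i => ?_) fun θ hθ => ?_
  · have := hΔ (κ i) (hκ1 i)
    omega
  · refine (hΔ' (κ i) (hκ1 i)).trans ?_
    exact hP.η_strictMonoOn.monotoneOn (Nat.le_add_left _ _ : 1 ≤ κ i + 1) (hκ1 (i + 1))
      (hκ i.lt_succ_self)
  · have e1 := hκ.tendsto_atTop.eventually (hηΔ.eventually (gt_mem_nhds hθ))
    have e2 := hκ.tendsto_atTop.eventually (hδη.eventually (gt_mem_nhds hθ))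
    obtain ⟨i₀, hi₀⟩ := eventually_atTop.1 (e1.and e2)
    refine ⟨i₀, fun i hi u hu1 hu2 => ?_⟩
    obtain ⟨h1, h2⟩ := hi₀ i hi
    have hη0 : (0 : ℝ) < η (κ i) := by exact_mod_cast hP.η_pos _ (hκ1 i)
    have hΔ0 : (0 : ℝ) < Δ (κ i) := by
      have := hΔ (κ i) (hκ1 i)
      have := hP.η_pos _ (hκ1 i)
      exact_mod_cast (show 0 < Δ (κ i) by omega)
    rw [div_lt_iff₀ hΔ0] at h1
    rw [div_lt_iff₀ hη0] at h2
    refine hP.card_norm_lt_le hp hs hs1 hΔ hT (hlead i).one_le hu1 (hηt i) (hpos i)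
      (fun j hj => (hstep i).2.2.2 j (hj.trans_le hu2)) ?_ hθ h2.le h1.le
    have : P.blockMass (f 0).1 (f 0).2 x ≤ P.blockMass (f i).1 (f i).2 x := hY (Nat.zero_le i)
    linarith

end IsSpecialCPlus

/-! ### Densities -/

theorem lowerDens_compl_eq_one {A : Set ℕ}
    (h : Tendsto (fun N : ℕ => ((A ∩ Set.Iic N).ncard : ℝ) / ((N : ℝ) + 1)) atTop (𝓝 0)) :
    lowerDens Aᶜ = 1 := by
  refine Tendsto.liminf_eq ?_
  have h1 := h.const_sub 1
  rw [sub_zero] at h1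
  refine h1.congr fun N => ?_
  have h2 : (A ∩ Set.Iic N).ncard + (Aᶜ ∩ Set.Iic N).ncard = N + 1 := by
    have h3 := Set.ncard_inter_add_ncard_sdiff_eq_ncard (Set.Iic N) A (Set.finite_Iic N)
    rw [Set.sdiff_eq, Set.inter_comm _ A, Set.inter_comm _ Aᶜ] at h3
    rw [h3, Set.ncard_eq_toFinset_card']
    simp
  have h4 : ((A ∩ Set.Iic N).ncard : ℝ) + (Aᶜ ∩ Set.Iic N).ncard = N + 1 := by exact_mod_cast h2
  have h5 : (N : ℝ) + 1 ≠ 0 := by positivity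
  rw [eq_div_iff h5, sub_mul, div_mul_cancel₀ _ h5]
  linarith

theorem IsUFrequentlyHypercyclicVector.isHypercyclicVector {E : Type*} [NormedAddCommGroup E]
    [NormedSpace ℂ E] {T : E →L[ℂ] E} {x : E} (h : IsUFrequentlyHypercyclicVector T x) :
    IsHypercyclicVector T x := by
  refine dense_iff_inter_open.2 fun U hU hne => ?_
  have h1 : (returnTimes T x U).Nonempty := by
    by_contra h0
    have h2 := h U hU hne
    rw [Set.not_nonempty_iff_eq_empty.1 h0] at h2
    simp [upperDens] at h2
  obtain ⟨n, hn⟩ := h1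
  exact ⟨_, hn, n, rfl⟩

theorem proposition4p4 (p : ℝ≥0∞) [Fact (1 ≤ p)] (hp : p ≠ ∞)
    (P : CTypeParams) (Δ τ δ η : ℕ → ℕ) (hP : IsSpecialCPlus P Δ τ δ η)
    (hγ_anti : AntitoneOn (gammaSeq p τ Δ) (Set.Ici 1))
    (hγ_summable : Summable fun k : ℕ => (2 : ℝ) ^ (k + 1) * gammaSeq p τ Δ (k + 1) ^ (1 / 2 : ℝ))
    (hγ_sum : ∑' k : ℕ, (2 : ℝ) ^ (k + 1) * gammaSeq p τ Δ (k + 1) ^ (1 / 2 : ℝ) ≤ 1)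
    (hΔ_lower : ∀ k, 1 ≤ k → 4 * δ k + 3 * η k ≤ Δ k)
    (hΔ_upper : ∀ k, 1 ≤ k → Δ k ≤ η (k + 1))
    (hηΔ : Tendsto (fun k => (η k : ℝ) / (Δ k : ℝ)) atTop (𝓝 0))
    (hδη : Tendsto (fun k => (δ k : ℝ) / (η k : ℝ)) atTop (𝓝 0)) :
    (∀ x : SeqSpace p, IsHypercyclicVector (P.operator p hp) x →
      ∃ ε : ℝ, 0 < ε ∧
        lowerDens (returnTimes (P.operator p hp) x (Metric.ball 0 ε)ᶜ) = 1) ∧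
    ¬ IsUFrequentlyHypercyclic (P.operator p hp) := by
  have key := fun {x : SeqSpace p} (hx : IsHypercyclicVector (P.operator p hp) x) =>
    hP.tendsto_ncard_norm_lt hp hγ_summable hγ_sum hΔ_lower hΔ_upper hηΔ hδη
      (P.operator_spec p hp) hx
  have hball : ∀ (x : SeqSpace p) (ε : ℝ), returnTimes (P.operator p hp) x (Metric.ball 0 ε) =
      {j | ‖((P.operator p hp) ^ j) x‖ < ε} := by
    intro x ε
    ext j
    simp [returnTimes]
  constructor
  · intro x hx
    obtain ⟨ε, hε, h⟩ := key hx
    refine ⟨ε, hε, ?_⟩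
    rw [← hball] at h
    exact lowerDens_compl_eq_one h
  · rintro ⟨x, hx⟩
    obtain ⟨ε, hε, h⟩ := key hx.isHypercyclicVector
    have h1 := hx _ Metric.isOpen_ball ⟨0, Metric.mem_ball_self hε⟩
    rw [hball, upperDens, h.limsup_eq] at h1
    exact lt_irrefl _ h1
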